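/- **Setting.** Identify $\mathbb R^2$ with $\mathbb C$. Let $A_0,\dots,A_\ell$ be the successive vertices of a polygon and let $A_q$ be one of them, with $\operatorname{Im}\frac{A_q-A_0}{A_\ell-A_0}>0$ (in particular $A_0\neq A_\ell$). Let $\Pi_0$ be the interior of the triangle $A_0A_\ell A_q$ and $\Pi_1=\overline{\Pi_0}$. For $1\le j\le \ell$ let $S_j$ be the orientation preserving map $S_j(z)=\frac{A_j-A_{j-1}}{A_\ell-A_0}(z-A_0)+A_{j-1}$, so that $S_j(A_0)=A_{j-1}$ and $S_j(A_\ell)=A_j$. The polygon is called a *basic figure* if * $A_1,A_{\ell-1}\in\overline{A_0A_\ell}$ and $A_{\ell-1}\in\overline{A_1A_\ell}$; * every vertex lies in $\{A_q\}\cup\overline{A_0A_\ell}\cup\Pi_0$; * every $S_j$ is a contractive similitude (its ratio lies in $(0,1)$), the sets $S_j(\Pi_0)$ are pairwise disjoint, and $S_j(A_q)\in\Pi_1$ for all $j$; * $S_j(\Pi_1)\cap(\overline{A_qA_0}\cup\overline{A_qA_\ell})=\emptyset$ for $j\notin\{1,\ell,q,q+1\}$. With arguments taken in $[0,2\pi)$,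 put $\theta_p=\arg\frac{S_p(A_q)-A_p}{S_{p+1}(A_q)-A_p}$ for $1\le p\le \ell-1$, $\theta_{\min}=\min_p\theta_p$, $\eta_1=\arg\frac{S_q(A_q)-A_q}{A_0-A_q}$, $\eta_2=\arg\frac{A_\ell-A_q}{S_{q+1}(A_q)-A_q}$. The *characteristic angle* of the basic figure is $\theta_{\min}+\min(\eta_1,\eta_2)$. A *regular self-similar arc* is an arc (a homeomorphic image of $[0,1]$) $\Lambda\subset\mathbb C$ which is the self-similar set of $S_1,\dots,S_\ell$ (the nonempty compact set with $\Lambda=\bigcup_{j=1}^\ell S_j(\Lambda)$) for some basic figure with positive characteristic angle. For points $x,y$ of an arc $\Lambda$, let $\Lambda(x,y)$ be the subarc between $x$ and $y$ and $|\Lambda(x,y)|$ its diameter. For $t\ge1$, $\Lambda$ is a *$t$-quasi-arc* if there is a constant $C>0$ with $|\Lambda(x,y)|^t\le C|x-y|$ for all $x,y\in\Lambda$. A function $f:E\to\mathbb R$ on a connected set $E\subset\mathbb R^2$ is a *Whitney function on $E$* if it is not constant and it is the restriction to $E$ of a $C^1$ function $F:\mathbb R^2\to\mathbb R$ with $\nabla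 F=0$ at every point of $E$. **Proposition.** Let $\Lambda$ be a regular self-similar arc, let $s=\dim_H\Lambda$, let $z_0$ be the initial point of $\Lambda$ (the end point of $\Lambda$ that lies in $S_1(\Lambda)$), and let $f:\Lambda\to\mathbb R$, $f(x)=H^s(\Lambda(z_0,x))$, be the $s$-dimensional Hausdorff measure function. 1. If $f$ is a Whitney function on $\Lambda$, then $\Lambda$ is an $s$-quasi-arc. 2. If $\Lambda$ is a $t$-quasi-arc for some $t$ with $1\le t<s$, then $f$ is a Whitney function on $\Lambda$. -/

import Mathlib

open Set MeasureTheory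
open scoped MeasureTheory unitInterval

noncomputable section

/-- The argument of a complex number, normalized to lie in `[0, 2π)`. -/
def argTwoPi (w : ℂ) : ℝ := toIcoMod Real.two_pi_pos 0 (Complex.arg w)

/-- The polygonal data `A 0, …, A ℓ` underlying a basic figure, with the index `q` of its apex.
Only the values `A j` with `j ≤ ℓ` play a role. -/
structure PolygonData where
  ℓ : ℕ
  A : ℕ → ℂ
  q : ℕ

namespace PolygonData

variable (Ω : PolygonData)

/-- The orientation preserving similitude `S j` (for `1 ≤ j ≤ ℓ`) of the complex plane
with `S j (A 0) = A (j - 1)` and `S j (A ℓ) = A j`. -/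
def S (j : ℕ) (z : ℂ) : ℂ :=
  (Ω.A j - Ω.A (j - 1)) / (Ω.A Ω.ℓ - Ω.A 0) * (z - Ω.A 0) + Ω.A (j - 1)

/-- The ratio of the similitude `S j`. -/
def ratio (j : ℕ) : ℝ := ‖(Ω.A j - Ω.A (j - 1)) / (Ω.A Ω.ℓ - Ω.A 0)‖

/-- The interior `Π₀` of the triangle with vertices `A 0`, `A ℓ`, `A q`. -/
def openTriangle : Set ℂ := interior (convexHull ℝ {Ω.A 0, Ω.A Ω.ℓ, Ω.A Ω.q})

/-- `Π₁`, the closure of `Π₀`. -/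
def closedTriangle : Set ℂ := closure Ω.openTriangle

/-- The conditions for a polygon `A 0, …, A ℓ` to be a basic figure with apex `A q`.
The condition `apex_pos` says that `A 0`, `A ℓ`, `A q` are not collinear
and that the triangle lies on the left of the directed base from `A 0` to `A ℓ`. -/
structure IsBasicFigure : Prop where
  q_le : Ω.q ≤ Ω.ℓ
  apex_pos : 0 < ((Ω.A Ω.q - Ω.A 0) / (Ω.A Ω.ℓ - Ω.A 0)).im
  first_mem : Ω.A 1 ∈ segment ℝ (Ω.A 0) (Ω.A Ω.ℓ)
  last_mem : Ω.A (Ω.ℓ - 1) ∈ segment ℝ (Ω.A 0) (Ω.A Ω.ℓ)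
  last_mem' : Ω.A (Ω.ℓ - 1) ∈ segment ℝ (Ω.A 1) (Ω.A Ω.ℓ)
  vertex_mem : ∀ j ≤ Ω.ℓ,
    Ω.A j ∈ {Ω.A Ω.q} ∪ segment ℝ (Ω.A 0) (Ω.A Ω.ℓ) ∪ Ω.openTriangle
  ratio_pos : ∀ j ∈ Icc 1 Ω.ℓ, 0 < Ω.ratio j
  ratio_lt_one : ∀ j ∈ Icc 1 Ω.ℓ, Ω.ratio j < 1
  disjoint : ∀ i ∈ Icc 1 Ω.ℓ, ∀ j ∈ Icc 1 Ω.ℓ, i ≠ j →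
    Disjoint (Ω.S i '' Ω.openTriangle) (Ω.S j '' Ω.openTriangle)
  apex_mem : ∀ j ∈ Icc 1 Ω.ℓ, Ω.S j (Ω.A Ω.q) ∈ Ω.closedTriangle
  sides : ∀ j ∈ Icc 1 Ω.ℓ, j ≠ 1 → j ≠ Ω.ℓ → j ≠ Ω.q → j ≠ Ω.q + 1 →
    (Ω.S j '' Ω.closedTriangle) ∩
      (segment ℝ (Ω.A Ω.q) (Ω.A 0) ∪ segment ℝ (Ω.A Ω.q) (Ω.A Ω.ℓ)) = ∅

/-- The corner angle `θ_p` at the vertex `A p`, for `1 ≤ p ≤ ℓ - 1`. -/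
def cornerAngle (p : ℕ) : ℝ :=
  argTwoPi ((Ω.S p (Ω.A Ω.q) - Ω.A p) / (Ω.S (p + 1) (Ω.A Ω.q) - Ω.A p))

/-- `θ_min`, the least of the corner angles `θ_1, …, θ_{ℓ-1}`
(for a basic figure the index set is finite and nonempty, so the infimum is a minimum). -/
def minCornerAngle : ℝ := sInf (Ω.cornerAngle '' Icc 1 (Ω.ℓ - 1))

/-- The angle `η₁` at the apex. -/
def eta₁ : ℝ :=
  argTwoPi ((Ω.S Ω.q (Ω.A Ω.q) - Ω.A Ω.q) / (Ω.A 0 - Ω.A Ω.q))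

/-- The angle `η₂` at the apex. -/
def eta₂ : ℝ :=
  argTwoPi ((Ω.A Ω.ℓ - Ω.A Ω.q) / (Ω.S (Ω.q + 1) (Ω.A Ω.q) - Ω.A Ω.q))

/-- The characteristic angle `ξ = θ_min + min (η₁, η₂)`. -/
def characteristicAngle : ℝ := Ω.minCornerAngle + min Ω.eta₁ Ω.eta₂

/-- `Λ` is the self-similar set of `S 1, …, S ℓ`: the nonempty compact set which is the union
of its images under these maps. -/
structure IsSelfSimilarSet (Λ : Set ℂ) : Prop where
  nonempty : Λ.Nonempty
  isCompact : IsCompact Λ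
  eq_iUnion : Λ = ⋃ j ∈ Icc 1 Ω.ℓ, Ω.S j '' Λ

/-- `Λ` is the regular self-similar arc generated by `Ω`: `Ω` is a basic figure with positive
characteristic angle, and the self-similar set `Λ` of `Ω` is an arc. -/
structure IsRegularSelfSimilarArc (Λ : Set ℂ) : Prop where
  isBasicFigure : Ω.IsBasicFigure
  isSelfSimilarSet : Ω.IsSelfSimilarSet Λ
  isArc : Nonempty (I ≃ₜ Λ)
  characteristicAngle_pos : 0 < Ω.characteristicAngle

end PolygonData

/-- The subarc `Λ(x, y)` between `x` and `y` of an arc `Λ` parametrized by `h : [0, 1] ≃ₜ Λ`. -/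
def subarc {Λ : Set ℂ} (h : I ≃ₜ Λ) (x y : Λ) : Set ℂ :=
  (fun u : I => (h u : ℂ)) '' uIcc (h.symm x) (h.symm y)

/-- `Λ` is a `t`-quasi-arc, `t ≥ 1`: an arc with `|Λ(x, y)| ^ t ≤ C |x - y|` for all
`x, y ∈ Λ`, where `|·|` is the diameter. The subarcs do not depend on the parametrization `h`. -/
def IsQuasiArc (t : ℝ) (Λ : Set ℂ) : Prop :=
  1 ≤ t ∧ ∃ h : I ≃ₜ Λ, ∃ C : ℝ, 0 < C ∧
    ∀ x y : Λ, Metric.diam (subarc h x y) ^ t ≤ C * dist x y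

/-- `f` is a Whitney function on the connected set `E`: a nonconstant restriction to `E`
of a `C¹` function on the plane whose derivative vanishes on `E`. -/
def IsWhitneyFunctionOn (E : Set ℂ) (f : E → ℝ) : Prop :=
  IsConnected E ∧
  (∃ F : ℂ → ℝ, ContDiff ℝ 1 F ∧ (∀ x ∈ E, fderiv ℝ F x = 0) ∧ ∀ x : E, F x = f x) ∧
  ∃ x y : E, f x ≠ f y

/-- The `s`-dimensional Hausdorff measure function `x ↦ H^s([h 0, x])` on an arc with
initial point `h 0`. -/
def hausdorffFunction {Λ : Set ℂ} (h : I ≃ₜ Λ) (s : ℝ) (x : Λ) : ℝ :=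
  (μH[s] (subarc h (h 0) x)).toReal

end

/-! The point is that `H^s` of a subarc is bounded below by a constant times the `s`-th power of its
diameter, and above likewise, while `|f x - f y|` is exactly the measure of `Λ(x, y)`
(`abs_hausdorffFunction_sub`).

The open triangle satisfies the open set condition. A packing argument (`exists_card_isStopping_le`)
then bounds the number of pieces of size about `d` that meet a set of diameter `d`. This gives
Moran's theorem, so `s` is the similarity dimension and `0 < H^s(Λ) < ∞`, and also the upper bound
`exists_hausdorffMeasure_inter_le`. For the lower bound, a subarc contains a similar copy of `Λ` of
comparable size (`exists_mul_diam_subarc_le`).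

If `f` extends to a `C¹` function, it is Lipschitz on the compact set `Λ`, and the lower bound turns
this into the `s`-quasi-arc inequality. Conversely, on a `t`-quasi-arc the upper bound gives `|f x -
f y| ≤ B' |x - y| ^ (s / t)`. As `s / t > 1`, Whitney's extension theorem with zero gradient field
applies (`exists_contDiff_extension_of_rpow`); `f` is nonconstant because `H^s(Λ) > 0`. -/

open Filter Topology ENNReal NNReal

/-! ### Similitude systems, words and the packing bound -/

/-- A finite family of orientation preserving contracting similitudes of the complex plane. -/
structure SimilitudeSystem (ι : Type*) where
  a : ι → ℂ
  b : ι → ℂ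
  a_ne_zero : ∀ i, a i ≠ 0
  norm_a_lt_one : ∀ i, ‖a i‖ < 1

namespace SimilitudeSystem

variable {ι : Type*} (Φ : SimilitudeSystem ι)

/-- The similitude with index `i`. -/
def map (i : ι) (z : ℂ) : ℂ := Φ.a i * z + Φ.b i

/-- The composition of the similitudes along a word. -/
def word : List ι → ℂ → ℂ
  | [], z => z
  | i :: w, z => Φ.map i (word w z)

/-- The ratio of the similitude belonging to a word. -/
noncomputable def scale (w : List ι) : ℝ := (w.map fun i => ‖Φ.a i‖).prod

/-- A word is stopping at scale `d` if it is the shortest of its prefixes with ratio at most `d`. -/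
def IsStopping (d : ℝ) (w : List ι) : Prop :=
  Φ.scale w ≤ d ∧ ∀ v, v <+: w → v ≠ w → d < Φ.scale v

/-- `K` is the union of its images under the system. -/
def IsInvariant (K : Set ℂ) : Prop := K = ⋃ i, Φ.map i '' K

/-- The open set condition. -/
structure OpenSetCondition (V : Set ℂ) : Prop where
  isOpen : IsOpen V
  nonempty : V.Nonempty
  image_subset : ∀ i, Φ.map i '' V ⊆ V
  disjoint : ∀ i j, i ≠ j → Disjoint (Φ.map i '' V) (Φ.map j '' V)

end SimilitudeSystem

/-- The word formed by the first `n` letters of a sequence. -/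
def initialWord {ι : Type*} (ω : ℕ → ι) (n : ℕ) : List ι := (List.range n).map ω

namespace SimilitudeSystem

variable {ι : Type*} (Φ : SimilitudeSystem ι)

lemma initialWord_succ (ω : ℕ → ι) (n : ℕ) : initialWord ω (n + 1) = initialWord ω n ++ [ω n] := by
  simp [initialWord, List.range_succ]

lemma length_initialWord (ω : ℕ → ι) (n : ℕ) : (initialWord ω n).length = n := by
  simp [initialWord]

lemma eq_initialWord_of_prefix {ω : ℕ → ι} {n : ℕ} {v : List ι} (h : v <+: initialWord ω n) :
    v = initialWord ω v.length ∧ v.length ≤ n := by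
  have hl := h.length_le
  rw [length_initialWord] at hl
  refine ⟨?_, hl⟩
  have := List.prefix_iff_eq_take.1 h
  rw [initialWord, ← List.map_take, List.take_range, min_eq_left hl] at this
  exact this

lemma initialWord_eq_iff {ω ω' : ℕ → ι} {n : ℕ} :
    initialWord ω n = initialWord ω' n ↔ ∀ i < n, ω i = ω' i := by
  simp [initialWord]

@[simp] lemma word_nil (z : ℂ) : Φ.word [] z = z := rfl

@[simp] lemma word_cons (i : ι) (w : List ι) (z : ℂ) : Φ.word (i :: w) z = Φ.map i (Φ.word w z) :=
  rfl

lemma word_append (u v : List ι) (z : ℂ) : Φ.word (u ++ v) z = Φ.word u (Φ.word v z) := by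
  induction u with
  | nil => rfl
  | cons i u ih => simp [ih]

@[simp] lemma scale_nil : Φ.scale [] = 1 := rfl

@[simp] lemma scale_cons (i : ι) (w : List ι) : Φ.scale (i :: w) = ‖Φ.a i‖ * Φ.scale w := by
  simp [scale]

lemma scale_append (u v : List ι) : Φ.scale (u ++ v) = Φ.scale u * Φ.scale v := by
  simp [scale]

lemma scale_pos (w : List ι) : 0 < Φ.scale w := by
  induction w with
  | nil => simp
  | cons i w ih =>
    rw [scale_cons]
    exact mul_pos (norm_pos_iff.2 (Φ.a_ne_zero i)) ih

lemma dist_map (i : ι) (x y : ℂ) : dist (Φ.map i x) (Φ.map i y) = ‖Φ.a i‖ * dist x y := by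
  simp [map, dist_eq_norm, ← mul_sub]

lemma dist_word (w : List ι) (x y : ℂ) :
    dist (Φ.word w x) (Φ.word w y) = Φ.scale w * dist x y := by
  induction w with
  | nil => simp
  | cons i w ih => simp [dist_map, ih, mul_assoc]

lemma injective_map (i : ι) : Function.Injective (Φ.map i) := fun x y h => by
  simpa [map, Φ.a_ne_zero i] using h

lemma surjective_word (w : List ι) : Function.Surjective (Φ.word w) := by
  induction w with
  | nil => exact fun z => ⟨z, rfl⟩
  | cons i w ih =>
    intro z
    obtain ⟨x, hx⟩ := ih ((z - Φ.b i) / Φ.a i)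
    refine ⟨x, ?_⟩
    have := Φ.a_ne_zero i
    simp [hx, map]
    field_simp
    ring

lemma lipschitzWith_word (w : List ι) : LipschitzWith (Φ.scale w).toNNReal (Φ.word w) :=
  LipschitzWith.of_dist_le_mul fun x y => by
    rw [Φ.dist_word w x y, Real.coe_toNNReal _ (Φ.scale_pos w).le]

lemma continuous_word (w : List ι) : Continuous (Φ.word w) := (Φ.lipschitzWith_word w).continuous

lemma antilipschitzWith_word (w : List ι) :
    AntilipschitzWith (Φ.scale w).toNNReal⁻¹ (Φ.word w) :=
  AntilipschitzWith.of_le_mul_dist fun x y => by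
    rw [Φ.dist_word w x y, NNReal.coe_inv, Real.coe_toNNReal _ (Φ.scale_pos w).le,
      inv_mul_cancel_left₀ (Φ.scale_pos w).ne']

lemma ball_subset_image_word (w : List ι) (c : ℂ) (ρ : ℝ) :
    Metric.ball (Φ.word w c) (Φ.scale w * ρ) ⊆ Φ.word w '' Metric.ball c ρ := by
  intro z hz
  obtain ⟨x, rfl⟩ := Φ.surjective_word w z
  rw [Metric.mem_ball, dist_word] at hz
  exact ⟨x, lt_of_mul_lt_mul_left hz (Φ.scale_pos w).le, rfl⟩

lemma image_word_subset {V : Set ℂ} (hV : ∀ i, Φ.map i '' V ⊆ V) (w : List ι) :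
    Φ.word w '' V ⊆ V := by
  induction w with
  | nil => exact (image_id' V).subset
  | cons i w ih =>
    rintro _ ⟨x, hx, rfl⟩
    exact hV i ⟨_, ih ⟨x, hx, rfl⟩, rfl⟩

/-- Neither word being a prefix of the other, they differ at some first letter. The common prefix
cancels by injectivity, and the first-level images at the differing letters are disjoint. -/
lemma disjoint_image_word {V : Set ℂ} (hV : Φ.OpenSetCondition V) :
    ∀ w v : List ι, ¬ w <+: v → ¬ v <+: w → Disjoint (Φ.word w '' V) (Φ.word v '' V)
  | [], v, h, _ => (h (List.nil_prefix)).elim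
  | _ :: _, [], _, h => (h (List.nil_prefix)).elim
  | i :: w, j :: v, h, h' => by
    by_cases hij : i = j
    · subst hij
      have := disjoint_image_word hV w v (fun H => h ((List.prefix_cons_inj i).2 H))
        (fun H => h' ((List.prefix_cons_inj i).2 H))
      have e : ∀ w, Φ.word (i :: w) '' V = Φ.map i '' (Φ.word w '' V) := fun w => by
        rw [image_image]; rfl
      rw [e, e]
      exact (disjoint_image_iff (Φ.injective_map i)).2 this
    · have e : ∀ i w, Φ.word (i :: w) '' V ⊆ Φ.map i '' V := fun i w => by
        rintro _ ⟨x, hx, rfl⟩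
        exact ⟨_, Φ.image_word_subset hV.image_subset w ⟨x, hx, rfl⟩, rfl⟩
      exact (hV.disjoint i j hij).mono (e i w) (e j v)

variable {Φ}

lemma IsStopping.eq_of_prefix {d : ℝ} {w w' : List ι} (h : Φ.IsStopping d w)
    (h' : Φ.IsStopping d w') (hp : w <+: w') : w = w' := by
  by_contra hne
  exact (h'.2 w hp hne).not_ge h.1

lemma IsStopping.eq_nil {d : ℝ} {w : List ι} (h : Φ.IsStopping d w) (hd : 1 ≤ d) : w = [] := by
  by_contra hne
  have := h.2 [] List.nil_prefix (Ne.symm hne)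
  simp at this
  linarith

/-- Removing the last letter gives a word of ratio greater than `d`, and a letter costs at most a
factor `m`. The condition `d < 1` excludes the empty word. -/
lemma IsStopping.mul_le_scale {d m : ℝ} (hm : 0 < m) (hm' : ∀ i, m ≤ ‖Φ.a i‖) (hd : d < 1)
    {w : List ι} (h : Φ.IsStopping d w) : m * d ≤ Φ.scale w := by
  rcases List.eq_nil_or_concat w with rfl | ⟨v, i, rfl⟩
  · have := h.1
    simp at this
    linarith
  · have h1 := h.2 v (by simp) (by simp)
    rw [List.concat_eq_append, scale_append] at *
    have := hm' i
    have h2 := Φ.scale_pos v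
    simp only [scale_cons, scale_nil, mul_one]
    nlinarith

variable (Φ)

lemma exists_pos_le_norm_a [Finite ι] [Nonempty ι] : ∃ m, 0 < m ∧ ∀ i, m ≤ ‖Φ.a i‖ := by
  obtain ⟨i, hi⟩ := Finite.exists_min fun i => ‖Φ.a i‖
  exact ⟨_, norm_pos_iff.2 (Φ.a_ne_zero i), hi⟩

lemma exists_norm_a_le [Finite ι] [Nonempty ι] : ∃ m, 0 < m ∧ m < 1 ∧ ∀ i, ‖Φ.a i‖ ≤ m := by
  obtain ⟨i, hi⟩ := Finite.exists_max fun i => ‖Φ.a i‖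
  exact ⟨_, norm_pos_iff.2 (Φ.a_ne_zero i), Φ.norm_a_lt_one i, hi⟩

lemma scale_le_pow {m : ℝ} (hm : ∀ i, ‖Φ.a i‖ ≤ m) (w : List ι) : Φ.scale w ≤ m ^ w.length := by
  induction w with
  | nil => simp
  | cons i w ih =>
    rw [scale_cons, List.length_cons, pow_succ']
    exact mul_le_mul (hm i) ih (Φ.scale_pos w).le ((norm_nonneg _).trans (hm i))

lemma tendsto_scale_initialWord [Finite ι] [Nonempty ι] (ω : ℕ → ι) :
    Tendsto (fun n => Φ.scale (initialWord ω n)) atTop (𝓝 0) := by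
  obtain ⟨m, hm0, hm1, hm⟩ := Φ.exists_norm_a_le
  refine squeeze_zero (fun n => (Φ.scale_pos _).le) (fun n => ?_)
    (tendsto_pow_atTop_nhds_zero_of_lt_one hm0.le hm1)
  simpa [length_initialWord] using Φ.scale_le_pow hm (initialWord ω n)

lemma exists_isStopping [Finite ι] [Nonempty ι] (ω : ℕ → ι) {d : ℝ} (hd : 0 < d) :
    ∃ n, Φ.IsStopping d (initialWord ω n) := by
  classical
  have hex : ∃ n, Φ.scale (initialWord ω n) ≤ d :=
    (((Φ.tendsto_scale_initialWord ω).eventually (gt_mem_nhds hd)).exists).imp fun n h => h.le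
  refine ⟨Nat.find hex, Nat.find_spec hex, fun v hv hne => ?_⟩
  obtain ⟨h1, h2⟩ := eq_initialWord_of_prefix hv
  have h3 : v.length < Nat.find hex := lt_of_le_of_ne h2 fun h => hne (by rw [← h]; exact h1)
  rw [h1]
  exact not_le.1 (Nat.find_min hex h3)

/-- Boundedly many stopping words at scale `d` have images that meet a set of diameter `d`. -/
theorem exists_card_isStopping_le [Finite ι] [Nonempty ι] {V : Set ℂ} (hV : Φ.OpenSetCondition V)
    {K : Set ℂ} (hK : Bornology.IsBounded K) :
    ∃ N : ℕ, ∀ d : ℝ, 0 < d → ∀ U : Set ℂ, (∀ x ∈ U, ∀ y ∈ U, dist x y ≤ d) →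
      ∃ W : Finset (List ι), W.card ≤ N ∧ (∀ w ∈ W, Φ.scale w ≤ d) ∧
        ∀ w, Φ.IsStopping d w → (Φ.word w '' K ∩ U).Nonempty → w ∈ W := by
  obtain ⟨c, hc⟩ := hV.nonempty
  obtain ⟨ρ, hρ, hball⟩ := Metric.isOpen_iff.1 hV.isOpen c hc
  obtain ⟨R, hR⟩ := hK.subset_ball c
  obtain ⟨m, hm, hm'⟩ := Φ.exists_pos_le_norm_a
  -- Ratio of the areas of two discs: all pieces lie within `(1 + R + ρ) d` of a point of `U`, and
  -- each contains its own disc of radius `m d ρ`.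
  set B := ((1 + R + ρ) / (m * ρ)) ^ 2 with hB
  refine ⟨⌈B⌉₊ + 1, fun d hd U hU => ?_⟩
  rcases le_or_gt 1 d with hd1 | hd1
  · refine ⟨{[]}, by simp, by simpa using hd1, fun w hw _ => by simp [hw.eq_nil hd1]⟩
  set T := {w | Φ.IsStopping d w ∧ (Φ.word w '' K ∩ U).Nonempty} with hT
  have key : ∀ W : Finset (List ι), (W : Set (List ι)) ⊆ T → (W.card : ℝ) ≤ B := by
    intro W hW
    rcases W.eq_empty_or_nonempty with rfl | ⟨w₀, hw₀⟩
    · simp only [Finset.card_empty, Nat.cast_zero]; positivity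
    obtain ⟨-, u, ⟨x₀, hx₀, -⟩, hu⟩ := hW hw₀
    have hR0 : 0 < R := dist_nonneg.trans_lt (hR hx₀)
    have hsub : ∀ w ∈ W, Metric.ball (Φ.word w c) (m * d * ρ) ⊆
        Metric.ball u ((1 + R + ρ) * d) := by
      intro w hw z hz
      obtain ⟨hst, y, ⟨x, hx, rfl⟩, hy⟩ := hW hw
      have h1 : dist (Φ.word w c) (Φ.word w x) ≤ d * R := by
        rw [dist_word]
        refine mul_le_mul hst.1 ?_ dist_nonneg hd.le
        rw [dist_comm]
        exact (hR hx).le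
      have h2 := hU _ hy _ hu
      have h3 : dist z (Φ.word w c) < m * d * ρ := hz
      have h4 : m * d * ρ ≤ d * ρ := by
        have : m ≤ 1 := (hm' (Classical.arbitrary ι)).trans (Φ.norm_a_lt_one _).le
        nlinarith [mul_pos hd hρ]
      rw [Metric.mem_ball]
      have := dist_triangle4 z (Φ.word w c) (Φ.word w x) u
      nlinarith
    -- Distinct stopping words are incomparable for the prefix order, so the discs lie in disjoint
    -- images of `V`.
    have hdisj : (W : Set (List ι)).PairwiseDisjoint
        fun w => Metric.ball (Φ.word w c) (m * d * ρ) := by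
      have hs : ∀ w ∈ W, Metric.ball (Φ.word w c) (m * d * ρ) ⊆ Φ.word w '' V := fun w hw =>
        (Metric.ball_subset_ball (mul_le_mul_of_nonneg_right
          ((hW hw).1.mul_le_scale hm hm' hd1) hρ.le)).trans
          ((Φ.ball_subset_image_word w c ρ).trans (image_mono hball))
      intro w hw w' hw' hne
      refine (Φ.disjoint_image_word hV w w' (fun h => hne ?_) fun h => hne ?_).mono
        (hs w hw) (hs w' hw')
      · exact (hW hw).1.eq_of_prefix (hW hw').1 h
      · exact ((hW hw').1.eq_of_prefix (hW hw).1 h).symm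
    have hvol : ∑ w ∈ W, volume (Metric.ball (Φ.word w c) (m * d * ρ)) ≤
        volume (Metric.ball u ((1 + R + ρ) * d)) := by
      rw [← measure_biUnion_finset hdisj fun _ _ => measurableSet_ball]
      exact measure_mono (iUnion₂_subset hsub)
    simp only [Complex.volume_ball, Finset.sum_const, nsmul_eq_mul] at hvol
    rw [← mul_assoc, ENNReal.mul_le_mul_iff_left (by simp [NNReal.pi_ne_zero]) (by simp),
      ← ENNReal.ofReal_pow (by positivity), ← ENNReal.ofReal_pow (by positivity),
      ← ENNReal.ofReal_natCast, ← ENNReal.ofReal_mul (by positivity),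
      ENNReal.ofReal_le_ofReal_iff (by positivity)] at hvol
    rw [hB, div_pow, le_div_iff₀ (by positivity)]
    have hd2 : 0 < d ^ 2 := by positivity
    refine le_of_mul_le_mul_right ?_ hd2
    nlinarith
  have hfin : T.Finite := by
    by_contra hinf
    obtain ⟨W, hW, hc⟩ := Set.Infinite.exists_subset_card_eq hinf (⌈B⌉₊ + 1)
    have := key W hW
    rw [hc] at this
    push_cast at this
    linarith [Nat.le_ceil B]
  refine ⟨hfin.toFinset, ?_, fun w hw => ?_, fun w hw hU' => hfin.mem_toFinset.2 ⟨hw, hU'⟩⟩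
  · have := (key hfin.toFinset (by simp)).trans (Nat.le_ceil B)
    have : hfin.toFinset.card ≤ ⌈B⌉₊ := by exact_mod_cast this
    lia
  · exact (hfin.mem_toFinset.1 hw).1.1

end SimilitudeSystem

/-! ### Hausdorff measure of self-similar sets -/

namespace SimilitudeSystem

variable {ι : Type*} (Φ : SimilitudeSystem ι)

lemma hausdorffMeasure_image_word {s : ℝ} (hs : 0 ≤ s) (w : List ι) (K : Set ℂ) :
    μH[s] (Φ.word w '' K) = ENNReal.ofReal (Φ.scale w ^ s) * μH[s] K := by
  have h0 := Φ.scale_pos w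
  have e : ENNReal.ofReal (Φ.scale w ^ s) = ((Φ.scale w).toNNReal : ℝ≥0∞) ^ s := by
    rw [← ENNReal.ofReal_rpow_of_pos h0]; rfl
  have hne : ((Φ.scale w).toNNReal : ℝ≥0∞) ≠ 0 := by
    simpa using h0
  rw [e]
  refine le_antisymm ((Φ.lipschitzWith_word w).hausdorffMeasure_image_le hs K) ?_
  have h := (Φ.antilipschitzWith_word w).le_hausdorffMeasure_image hs K
  calc _ ≤ ((Φ.scale w).toNNReal : ℝ≥0∞) ^ s *
        (((Φ.scale w).toNNReal⁻¹ : ℝ≥0) ^ s * μH[s] (Φ.word w '' K)) := by gcongr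
    _ = μH[s] (Φ.word w '' K) := by
      rw [← mul_assoc, ← ENNReal.mul_rpow_of_nonneg _ _ hs, ENNReal.coe_inv (by simpa using h0),
        ENNReal.mul_inv_cancel hne ENNReal.coe_ne_top, ENNReal.one_rpow, one_mul]

variable {Φ} {K : Set ℂ}

lemma IsInvariant.image_subset (hK : Φ.IsInvariant K) (i : ι) : Φ.map i '' K ⊆ K := by
  conv_rhs => rw [hK]
  exact subset_iUnion (fun i => Φ.map i '' K) i

/-- Every point of an invariant set has an address. -/
lemma IsInvariant.exists_address (hK : Φ.IsInvariant K) {x : ℂ} (hx : x ∈ K) :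
    ∃ ω : ℕ → ι, ∀ n, x ∈ Φ.word (initialWord ω n) '' K := by
  have hpre : ∀ y : K, ∃ i, ∃ z : K, Φ.map i z = y := by
    rintro ⟨y, hy⟩
    rw [hK] at hy
    obtain ⟨i, z, hz, rfl⟩ := mem_iUnion.1 hy
    exact ⟨i, ⟨z, hz⟩, rfl⟩
  choose i g hg using hpre
  let X : ℕ → K := fun n => g^[n] ⟨x, hx⟩
  refine ⟨fun n => i (X n), fun n => ⟨X n, (X n).2, ?_⟩⟩
  induction n with
  | zero => rfl
  | succ n ih =>
    have : X (n + 1) = g (X n) := Function.iterate_succ_apply' g n _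
    rw [initialWord_succ, word_append, this]
    simpa [hg] using ih

lemma ofFn_eq_initialWord (ω : ℕ → ι) (n : ℕ) :
    List.ofFn (fun i : Fin n => ω i) = initialWord ω n := by
  apply List.ext_getElem <;> simp [initialWord]

/-- An invariant compact set has finite Hausdorff measure in the similarity dimension. -/
theorem IsInvariant.hausdorffMeasure_lt_top [Fintype ι] [Nonempty ι] (hK : Φ.IsInvariant K)
    (hc : Bornology.IsBounded K) {s : ℝ} (hs : 0 < s) (hsum : ∑ i, ‖Φ.a i‖ ^ s = 1) :
    μH[s] K < ∞ := by
  obtain ⟨m, hm0, hm1, hm⟩ := Φ.exists_norm_a_le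
  have hdiam : Metric.ediam K ≠ ∞ := Metric.isBounded_iff_ediam_ne_top.1 hc
  have hed : ∀ w : List ι, Metric.ediam (Φ.word w '' K) ≤
      ENNReal.ofReal (Φ.scale w) * Metric.ediam K := fun w =>
    (Φ.lipschitzWith_word w).ediam_image_le K
  -- Cover by the pieces of level `n`: their `s`-sums factor as `(∑ ‖a i‖ ^ s) ^ n = 1` times `diam
  -- K ^ s`.
  have hle := Measure.hausdorffMeasure_le_liminf_sum (β := ℕ) (ι := fun n => Fin n → ι) s K
    (l := atTop) (fun n => ENNReal.ofReal (m ^ n) * Metric.ediam K) ?_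
    (fun n p => Φ.word (List.ofFn p) '' K) (Eventually.of_forall fun n p => ?_)
    (Eventually.of_forall fun n x hx => ?_)
  · refine hle.trans_lt (lt_of_le_of_lt (liminf_le_of_frequently_le' (x := Metric.ediam K ^ s)
      (Frequently.of_forall fun n => ?_)) (ENNReal.rpow_lt_top_of_nonneg hs.le hdiam))
    calc ∑ p : Fin n → ι, Metric.ediam (Φ.word (List.ofFn p) '' K) ^ s
        ≤ ∑ p : Fin n → ι, ENNReal.ofReal (∏ j, ‖Φ.a (p j)‖ ^ s) * Metric.ediam K ^ s := by
          refine Finset.sum_le_sum fun p _ => ?_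
          refine (ENNReal.rpow_le_rpow (hed _) hs.le).trans_eq ?_
          rw [ENNReal.mul_rpow_of_nonneg _ _ hs.le,
            ENNReal.ofReal_rpow_of_nonneg (Φ.scale_pos _).le hs.le]
          congr 2
          rw [scale, List.map_ofFn, List.prod_ofFn,
            Real.finsetProd_rpow _ _ fun _ _ => norm_nonneg _]
          rfl
      _ = Metric.ediam K ^ s := by
          rw [← Finset.sum_mul, ← ENNReal.ofReal_sum_of_nonneg fun _ _ => by positivity,
            ← Fintype.sum_pow (fun i => ‖Φ.a i‖ ^ s), hsum]
          simp
  · have : Tendsto (fun n : ℕ => ENNReal.ofReal (m ^ n)) atTop (𝓝 (ENNReal.ofReal 0)) :=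
      ENNReal.tendsto_ofReal (tendsto_pow_atTop_nhds_zero_of_lt_one hm0.le hm1)
    simpa using ENNReal.Tendsto.mul_const this (Or.inr hdiam)
  · refine (hed _).trans ?_
    gcongr
    simpa using Φ.scale_le_pow hm (List.ofFn p)
  · obtain ⟨ω, hω⟩ := hK.exists_address hx
    refine mem_iUnion.2 ⟨fun i => ω i, ?_⟩
    rw [ofFn_eq_initialWord]
    exact hω n

/-- Upper regularity of the Hausdorff measure on an invariant set. -/
theorem IsInvariant.exists_hausdorffMeasure_inter_le [Fintype ι] [Nonempty ι]
    (hK : Φ.IsInvariant K) (hc : Bornology.IsBounded K) {V : Set ℂ} (hV : Φ.OpenSetCondition V)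
    {s : ℝ} (hs : 0 < s) (hsum : ∑ i, ‖Φ.a i‖ ^ s = 1) :
    ∃ C : ℝ, 0 < C ∧ ∀ d : ℝ, 0 < d → ∀ U ⊆ K, (∀ x ∈ U, ∀ y ∈ U, dist x y ≤ d) →
      (μH[s] U).toReal ≤ C * d ^ s := by
  obtain ⟨N, hN⟩ := Φ.exists_card_isStopping_le hV hc
  have hfin := hK.hausdorffMeasure_lt_top hc hs hsum
  refine ⟨N * (μH[s] K).toReal + 1, by positivity, fun d hd U hUK hU => ?_⟩
  obtain ⟨W, hWc, hWd, hW⟩ := hN d hd U hU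
  -- Every address has a stopping prefix, so the boundedly many stopping pieces that meet `U` cover
  -- it.
  have hcov : U ⊆ ⋃ w ∈ W, Φ.word w '' K := by
    intro x hx
    obtain ⟨ω, hω⟩ := hK.exists_address (hUK hx)
    obtain ⟨n, hn⟩ := Φ.exists_isStopping ω hd
    exact mem_iUnion₂.2 ⟨_, hW _ hn ⟨x, hω n, hx⟩, hω n⟩
  have hle : μH[s] U ≤ ENNReal.ofReal (N * d ^ s * (μH[s] K).toReal) := by
    calc μH[s] U ≤ ∑ w ∈ W, μH[s] (Φ.word w '' K) :=
          (measure_mono hcov).trans (measure_biUnion_finset_le _ _)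
      _ ≤ ∑ w ∈ W, ENNReal.ofReal (d ^ s) * μH[s] K := by
          refine Finset.sum_le_sum fun w hw => ?_
          rw [hausdorffMeasure_image_word _ hs.le]
          gcongr
          · exact (Φ.scale_pos w).le
          · exact hWd w hw
      _ = W.card * (ENNReal.ofReal (d ^ s) * μH[s] K) := by simp
      _ ≤ N * (ENNReal.ofReal (d ^ s) * μH[s] K) := by gcongr
      _ = _ := by
          rw [ENNReal.ofReal_mul (by positivity), ENNReal.ofReal_mul (by positivity),
            ENNReal.ofReal_toReal hfin.ne, ENNReal.ofReal_natCast, mul_assoc]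
  refine (ENNReal.toReal_le_of_le_ofReal (by positivity) hle).trans ?_
  have : 0 < d ^ s := by positivity
  nlinarith

/-- The address map of a compact invariant set. -/
lemma IsInvariant.exists_coding [Finite ι] [Nonempty ι] [TopologicalSpace ι] [DiscreteTopology ι]
    (hK : Φ.IsInvariant K) (hc : IsCompact K) (hne : K.Nonempty) :
    ∃ π : (ℕ → ι) → ℂ, Continuous π ∧ ∀ ω n, π ω ∈ Φ.word (initialWord ω n) '' K := by
  have hex : ∀ ω : ℕ → ι, (⋂ n, Φ.word (initialWord ω n) '' K).Nonempty := fun ω => by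
    refine IsCompact.nonempty_iInter_of_sequence_nonempty_isCompact_isClosed _ (fun n => ?_)
      (fun n => hne.image _) (hc.image (Φ.continuous_word _))
      (fun n => (hc.image (Φ.continuous_word _)).isClosed)
    rw [initialWord_succ]
    rintro _ ⟨x, hx, rfl⟩
    rw [word_append]
    exact ⟨_, hK.image_subset (ω n) ⟨x, hx, rfl⟩, rfl⟩
  choose π hπ using hex
  have hπ' : ∀ ω n, π ω ∈ Φ.word (initialWord ω n) '' K := fun ω n => mem_iInter.1 (hπ ω) n
  refine ⟨π, continuous_iff_continuousAt.2 fun ω => Metric.tendsto_nhds.2 fun ε hε => ?_, hπ'⟩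
  have ht : Tendsto (fun n => Φ.scale (initialWord ω n) * Metric.diam K) atTop (𝓝 0) := by
    simpa using (Φ.tendsto_scale_initialWord ω).mul_const (Metric.diam K)
  obtain ⟨n, hn⟩ := (ht.eventually (gt_mem_nhds hε)).exists
  have hnhds : ∀ᶠ ω' in 𝓝 ω, ∀ i < n, ω' i = ω i := by
    have : ∀ i, ∀ᶠ ω' in 𝓝 ω, ω' i = ω i := fun i =>
      (continuous_apply i).continuousAt.eventually (mem_nhds_discrete.2 (mem_singleton (ω i)))
    exact (eventually_all_finite (finite_Iio n)).2 fun i _ => this i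
  filter_upwards [hnhds] with ω' hω'
  obtain ⟨x, hx, hx'⟩ := hπ' ω n
  obtain ⟨y, hy, hy'⟩ := hπ' ω' n
  rw [initialWord_eq_iff.2 hω'] at hy'
  rw [← hx', ← hy', dist_word]
  refine lt_of_le_of_lt ?_ hn
  exact mul_le_mul_of_nonneg_left (Metric.dist_le_diam_of_mem hc.isBounded hy hx)
    (Φ.scale_pos _).le

/-- Moran's theorem: under the open set condition a compact invariant set has positive Hausdorff
measure in the similarity dimension. -/
theorem IsInvariant.hausdorffMeasure_pos [Fintype ι] [Nonempty ι]
    (hK : Φ.IsInvariant K) (hc : IsCompact K) (hne : K.Nonempty) {V : Set ℂ}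
    (hV : Φ.OpenSetCondition V) {s : ℝ} (hs : 0 < s) (hsum : ∑ i, ‖Φ.a i‖ ^ s = 1) :
    0 < μH[s] K := by
  let : TopologicalSpace ι := ⊥
  have : DiscreteTopology ι := ⟨rfl⟩
  let : MeasurableSpace ι := ⊤
  have : BorelSpace ι := ⟨borel_eq_top_of_discrete.symm⟩
  obtain ⟨π, hπc, hπ⟩ := hK.exists_coding hc hne
  -- Mass distribution principle: the Bernoulli measure with weights `‖a i‖ ^ s`, pushed forward by
  -- the coding map, has mass at most a constant times `diam U ^ s` on small sets, hence is
  -- dominated by a multiple of `H^s`.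
  let p : Measure ι := ∑ i, ENNReal.ofReal (‖Φ.a i‖ ^ s) • Measure.dirac i
  have hp1 : ∀ i, p {i} = ENNReal.ofReal (‖Φ.a i‖ ^ s) := fun i => by
    classical
    simp only [p, Measure.coe_finsetSum, Measure.coe_smul, Finset.sum_apply, Pi.smul_apply,
      Measure.dirac_apply, smul_eq_mul]
    rw [Finset.sum_eq_single i] <;> simp +contextual [indicator]
  have : IsProbabilityMeasure p := ⟨by
    simp only [p, Measure.coe_finsetSum, Measure.coe_smul, Finset.sum_apply, Pi.smul_apply,
      measure_univ, smul_eq_mul, mul_one]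
    rw [← ENNReal.ofReal_sum_of_nonneg fun _ _ => by positivity, hsum, ENNReal.ofReal_one]⟩
  let P : Measure (ℕ → ι) := Measure.infinitePi fun _ => p
  have hcyl : ∀ w : List ι, P {ω | initialWord ω w.length = w} ≤
      ENNReal.ofReal (Φ.scale w ^ s) := by
    intro w
    rcases eq_empty_or_nonempty {ω : ℕ → ι | initialWord ω w.length = w} with h | ⟨ω₀, h₀⟩
    · simp [h]
    have h₀ : initialWord ω₀ w.length = w := h₀
    have hset : {ω | initialWord ω w.length = w} =
        (↑(Finset.range w.length) : Set ℕ).pi fun i => {ω₀ i} := by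
      ext ω
      simp only [mem_ofPred_eq, Set.mem_pi, Finset.coe_range, mem_Iio, mem_singleton_iff]
      conv_lhs => rw [← h₀, length_initialWord, initialWord_eq_iff]
    rw [hset, Measure.infinitePi_pi _ fun _ _ => MeasurableSet.of_discrete]
    simp only [hp1]
    rw [← ENNReal.ofReal_prod_of_nonneg fun _ _ => by positivity,
      Real.finsetProd_rpow _ _ fun _ _ => norm_nonneg _]
    conv_rhs => rw [← h₀]
    rw [scale, initialWord, List.map_map, Finset.prod_range, ← List.prod_ofFn]
    refine le_of_eq ?_
    congr 3
    apply List.ext_getElem <;> simp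
  obtain ⟨N, hN⟩ := Φ.exists_card_isStopping_le hV hc.isBounded
  have hdecay : ∀ d : ℝ, 0 < d → ∀ U : Set ℂ, (∀ x ∈ U, ∀ y ∈ U, dist x y ≤ d) →
      P (π ⁻¹' U) ≤ N * ENNReal.ofReal d ^ s := by
    intro d hd U hU
    obtain ⟨W, hWc, hWd, hW⟩ := hN d hd U hU
    have hcov : π ⁻¹' U ⊆ ⋃ w ∈ W, {ω | initialWord ω w.length = w} := by
      intro ω hω
      obtain ⟨n, hn⟩ := Φ.exists_isStopping ω hd
      refine mem_iUnion₂.2 ⟨_, hW _ hn ⟨π ω, hπ ω n, hω⟩, ?_⟩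
      simp [length_initialWord]
    calc P (π ⁻¹' U) ≤ ∑ w ∈ W, P {ω | initialWord ω w.length = w} :=
          (measure_mono hcov).trans (measure_biUnion_finset_le _ _)
      _ ≤ ∑ w ∈ W, ENNReal.ofReal d ^ s := by
          refine Finset.sum_le_sum fun w hw => (hcyl w).trans ?_
          rw [ENNReal.ofReal_rpow_of_pos hd]
          gcongr
          · exact (Φ.scale_pos w).le
          · exact hWd w hw
      _ = W.card * ENNReal.ofReal d ^ s := by simp
      _ ≤ N * ENNReal.ofReal d ^ s := by gcongr
  -- The closure makes the set measurable without changing its diameter. The counting bound needs a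
  -- positive scale, so it is used at `diam U + δ` with `δ → 0`. Taking `N + 1` keeps the constant
  -- invertible.
  have hdecay' : ∀ U : Set ℂ, Metric.ediam U ≤ 1 →
      P.map π U ≤ (N + 1) * Metric.ediam U ^ s := by
    intro U hU
    refine (measure_mono (subset_closure (s := U))).trans ?_
    rw [Measure.map_apply hπc.measurable measurableSet_closure, ← Metric.ediam_closure]
    rw [← Metric.ediam_closure] at hU
    generalize closure U = U at hU ⊢
    have hne : Metric.ediam U ≠ ∞ := (hU.trans_lt ENNReal.one_lt_top).ne
    have hb : ∀ δ : ℝ, 0 < δ → P (π ⁻¹' U) ≤ N * ENNReal.ofReal (Metric.diam U + δ) ^ s :=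
      fun δ hδ => hdecay _ (by positivity) U fun x hx y hy =>
        (Metric.dist_le_diam_of_mem' hne hx hy).trans (by linarith)
    have hlim : Tendsto (fun δ : ℝ => (N : ℝ≥0∞) * ENNReal.ofReal (Metric.diam U + δ) ^ s)
        (𝓝[>] 0) (𝓝 (N * ENNReal.ofReal (Metric.diam U + 0) ^ s)) := by
      refine ENNReal.Tendsto.const_mul ?_ (Or.inr (by simp))
      refine Tendsto.ennrpow_const _ (ENNReal.tendsto_ofReal ?_)
      exact (tendsto_const_nhds.add tendsto_id).mono_left nhdsWithin_le_nhds
    have := ge_of_tendsto hlim (eventually_nhdsWithin_of_forall hb)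
    rw [add_zero, Metric.diam, ENNReal.ofReal_toReal hne] at this
    exact this.trans (by gcongr; simp)
  have hle : ((N : ℝ≥0∞) + 1)⁻¹ • P.map π ≤ μH[s] :=
    Measure.le_hausdorffMeasure s _ 1 one_pos fun U hU => by
      rw [Measure.smul_apply, smul_eq_mul]
      calc _ ≤ ((N : ℝ≥0∞) + 1)⁻¹ * ((N + 1) * Metric.ediam U ^ s) := by
            gcongr; exact hdecay' U hU
        _ = _ := by
            rw [← mul_assoc, ENNReal.inv_mul_cancel (by simp) (by simp), one_mul]
  have hK1 : P.map π K = 1 := by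
    rw [Measure.map_apply hπc.measurable hc.measurableSet]
    have : π ⁻¹' K = univ := eq_univ_of_forall fun ω => by
      have := hπ ω 0
      simpa [initialWord] using this
    rw [this, measure_univ]
  refine lt_of_lt_of_le ?_ (hle K)
  simp [hK1]

/-- The similarity dimension exists. -/
lemma exists_similarity_dimension [Fintype ι] [Nontrivial ι] (Φ : SimilitudeSystem ι) :
    ∃ s : ℝ, 0 < s ∧ ∑ i, ‖Φ.a i‖ ^ s = 1 := by
  have hpos : ∀ i, 0 < ‖Φ.a i‖ := fun i => norm_pos_iff.2 (Φ.a_ne_zero i)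
  have hlim : Tendsto (fun s : ℝ => ∑ i, ‖Φ.a i‖ ^ s) atTop (𝓝 0) := by
    have : Tendsto (fun s : ℝ => ∑ i, ‖Φ.a i‖ ^ s) atTop (𝓝 (∑ _i : ι, (0 : ℝ))) :=
      tendsto_finsetSum _ fun i _ => tendsto_rpow_atTop_of_base_lt_one _
        (by linarith [hpos i]) (Φ.norm_a_lt_one i)
    simpa using this
  obtain ⟨M, hM, hM0⟩ := ((hlim.eventually (gt_mem_nhds one_pos)).and
    (eventually_gt_atTop 0)).exists
  have hcont : ContinuousOn (fun s : ℝ => ∑ i, ‖Φ.a i‖ ^ s) (Icc 0 M) :=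
    (continuous_finsetSum _ fun i _ =>
      Real.continuous_const_rpow (hpos i).ne').continuousOn
  have hcard : 1 < Fintype.card ι := Fintype.one_lt_card
  have h0 : (1 : ℝ) < ∑ i, ‖Φ.a i‖ ^ (0 : ℝ) := by
    simp only [Real.rpow_zero, Finset.sum_const, nsmul_eq_mul, mul_one]
    exact_mod_cast hcard
  obtain ⟨s, hs, h⟩ := intermediate_value_Icc' hM0.le hcont ⟨hM.le, h0.le⟩
  -- At `s = 0` the sum is the number of maps, which exceeds one.
  refine ⟨s, lt_of_le_of_ne hs.1 ?_, h⟩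
  rintro rfl
  exact h0.ne' h

end SimilitudeSystem

/-! ### Mollification and Whitney extension -/

/-- A general bilinear `L` lets one estimate serve both the mollified function and its derivative,
where the kernel is the derivative of the bump. -/
lemma exists_norm_convolution_le {F G : Type*} [NormedAddCommGroup F] [NormedSpace ℝ F]
    [NormedAddCommGroup G] [NormedSpace ℝ G] (L : F →L[ℝ] ℝ →L[ℝ] G) {k : ℂ → F}
    (hk : Integrable k) (hsupp : Function.support k ⊆ Metric.closedBall 0 1) :
    ∃ M : ℝ, 0 ≤ M ∧ ∀ (h : ℂ → ℝ) (u : ℂ) (δ : ℝ), (∀ y, dist y u ≤ 1 → |h y| ≤ δ) →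
      ‖convolution k h L volume u‖ ≤ M * δ := by
  refine ⟨‖L‖ * ∫ t, ‖k t‖, mul_nonneg L.opNorm_nonneg (integral_nonneg fun _ => norm_nonneg _),
    fun h u δ hh => ?_⟩
  have hb : ∀ t, ‖L (k t) (h (u - t))‖ ≤ ‖L‖ * δ * ‖k t‖ := by
    intro t
    by_cases ht : k t = 0
    · simp [ht]
    · have h1 : dist (u - t) u ≤ 1 := by
        simpa using hsupp ht
      calc ‖L (k t) (h (u - t))‖ ≤ ‖L‖ * ‖k t‖ * ‖h (u - t)‖ := L.le_opNorm₂ _ _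
        _ ≤ ‖L‖ * ‖k t‖ * δ := by
          gcongr
          exact hh _ h1
        _ = _ := by ring
  calc ‖convolution k h L volume u‖ ≤ ∫ t, ‖L‖ * δ * ‖k t‖ :=
        norm_integral_le_of_norm_le (hk.norm.const_mul _) (Eventually.of_forall hb)
    _ = _ := by rw [integral_const_mul]; ring

/-- Mollification at scale `ε`, with bounds for the value and the derivative in terms of the
oscillation. -/
theorem exists_mollification :
    ∃ M : ℝ, 1 ≤ M ∧ ∀ ε : ℝ, 0 < ε → ∀ g : ℂ → ℝ, Continuous g → ∃ G : ℂ → ℝ,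
      ContDiff ℝ 1 G ∧ ∀ z c δ, (∀ y, dist y z ≤ ε → |g y - c| ≤ δ) →
        |G z - c| ≤ M * δ ∧ ‖fderiv ℝ G z‖ ≤ M * δ / ε := by
  let b : ContDiffBump (0 : ℂ) := ⟨1 / 2, 1, by norm_num, by norm_num⟩
  let φ : ℂ → ℝ := b.normed volume
  have hφ : ContDiff ℝ 1 φ := b.contDiff_normed (n := 1)
  have hφc : HasCompactSupport φ := b.hasCompactSupport_normed
  have hφ1 : ∫ t, φ t = 1 := b.integral_normed
  have hφs : Function.support φ ⊆ Metric.closedBall 0 1 := by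
    rw [ContDiffBump.support_normed_eq]
    exact Metric.ball_subset_closedBall
  have hφi : Integrable φ := hφ.continuous.integrable_of_hasCompactSupport hφc
  have hdi : Integrable (fderiv ℝ φ) :=
    (hφ.continuous_fderiv one_ne_zero).integrable_of_hasCompactSupport (hφc.fderiv ℝ)
  have hds : Function.support (fderiv ℝ φ) ⊆ Metric.closedBall 0 1 :=
    (support_fderiv_subset ℝ).trans (closure_minimal hφs Metric.isClosed_closedBall)
  let L : ℝ →L[ℝ] ℝ →L[ℝ] ℝ := ContinuousLinearMap.lsmul ℝ ℝ
  obtain ⟨M₀, hM₀, hval⟩ := exists_norm_convolution_le L hφi hφs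
  obtain ⟨M₁, hM₁, hder⟩ := exists_norm_convolution_le (L.precompL ℂ) hdi hds
  refine ⟨1 + M₀ + M₁, by linarith, fun ε hε g hg => ?_⟩
  have hgc : ∀ c : ℝ, Continuous fun u : ℂ => g (ε • u) - c := fun c => by fun_prop
  let ψ : ℝ → ℂ → ℝ := fun c => convolution φ (fun u => g (ε • u) - c) L volume
  -- The kernel has mass one, so a constant may be subtracted before convolving; this brings in the
  -- oscillation about `c` in place of the size of `g`.
  have hψ : ∀ c u, ψ 0 u = ψ c u + c := by
    intro c u
    have hex : ConvolutionExists φ (fun u => g (ε • u) - c) L volume :=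
      hφc.convolutionExists_left L hφ.continuous (hgc c).locallyIntegrable
    have hi : Integrable fun t => φ t * (g (ε • (u - t)) - c) := hex u
    calc ψ 0 u = ∫ t, φ t * (g (ε • (u - t)) - 0) := rfl
      _ = ∫ t, (φ t * (g (ε • (u - t)) - c) + φ t * c) := by
        congr 1; ext t; ring
      _ = (∫ t, φ t * (g (ε • (u - t)) - c)) + ∫ t, φ t * c :=
        integral_add hi (hφi.mul_const c)
      _ = ψ c u + c := by
        rw [integral_mul_const, hφ1, one_mul]; rfl
  -- Convolution takes place at unit scale; undoing the dilation produces the factor `1 / ε` in the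
  -- derivative.
  refine ⟨fun z => ψ 0 (ε⁻¹ • z), ?_, fun z c δ hδ => ?_⟩
  · exact (hφc.contDiff_convolution_left L (n := 1) hφ (hgc 0).locallyIntegrable).comp
      (contDiff_const_smul _)
  · have hosc : ∀ y, dist y (ε⁻¹ • z) ≤ 1 → |g (ε • y) - c| ≤ δ := by
      intro y hy
      refine hδ _ ?_
      have : ε • y - z = ε • (y - ε⁻¹ • z) := by
        rw [smul_sub, smul_inv_smul₀ hε.ne']
      rw [dist_eq_norm] at hy ⊢
      rw [this, norm_smul, Real.norm_of_nonneg hε.le]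
      nlinarith
    have hδ0 : 0 ≤ δ := (abs_nonneg _).trans (hδ z (by simpa using hε.le))
    constructor
    · beta_reduce
      rw [hψ c, add_sub_cancel_right]
      refine (hval _ _ δ hosc).trans ?_
      exact mul_le_mul_of_nonneg_right (by linarith) hδ0
    · have hd := hφc.hasFDerivAt_convolution_left (μ := volume) L hφ (hgc c).locallyIntegrable (ε⁻¹ • z)
      have hs : HasFDerivAt (fun z : ℂ => ε⁻¹ • z) (ε⁻¹ • ContinuousLinearMap.id ℝ ℂ) z :=
        (hasFDerivAt_id z).const_smul ε⁻¹
      have hcomp := (hd.comp z hs).add_const c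
      have hfun : (fun z => ψ 0 (ε⁻¹ • z)) = fun z =>
          (convolution φ (fun u => g (ε • u) - c) L volume ∘ fun z => ε⁻¹ • z) z + c := by
        ext z; exact hψ c _
      rw [hfun, hcomp.fderiv, ContinuousLinearMap.comp_smul, ContinuousLinearMap.comp_id,
        norm_smul, norm_inv, Real.norm_of_nonneg hε.le, div_eq_inv_mul]
      have := hder _ _ δ hosc
      refine mul_le_mul_of_nonneg_left (this.trans ?_) (inv_nonneg.2 hε.le)
      exact mul_le_mul_of_nonneg_right (by linarith) hδ0

lemma rpow_add_le_two_rpow_mul {a b α : ℝ} (ha : 0 ≤ a) (hb : 0 ≤ b) (hα : 0 ≤ α) :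
    (a + b) ^ α ≤ 2 ^ α * (a ^ α + b ^ α) := by
  have h1 : (a + b) ^ α ≤ (2 * max a b) ^ α :=
    Real.rpow_le_rpow (by positivity) (by linarith [le_max_left a b, le_max_right a b]) hα
  rw [Real.mul_rpow (by norm_num) (ha.trans (le_max_left a b))] at h1
  refine h1.trans (mul_le_mul_of_nonneg_left ?_ (by positivity))
  rcases max_choice a b with h | h <;> rw [h] <;> nlinarith [Real.rpow_nonneg ha α,
    Real.rpow_nonneg hb α]

/-- A continuous extension that keeps a Hölder bound of arbitrary exponent at the points of the
original set. -/
theorem exists_continuous_extension_of_rpow {E : Set ℂ} (hE : IsCompact E) (hne : E.Nonempty)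
    {f : E → ℝ} {C α : ℝ} (hC : 0 ≤ C) (hα : 0 < α)
    (hf : ∀ x y : E, |f x - f y| ≤ C * dist x y ^ α) :
    ∃ (g : ℂ → ℝ) (B : ℝ), Continuous g ∧ 0 ≤ B ∧
      ∀ (z : ℂ) (x : E), |g z - f x| ≤ B * dist z x ^ α := by
  have : CompactSpace E := isCompact_iff_compactSpace.1 hE
  have : Nonempty E := hne.to_subtype
  have hfc : Continuous f := by
    refine continuous_iff_continuousAt.2 fun y => tendsto_iff_dist_tendsto_zero.2 ?_
    refine squeeze_zero (fun _ => dist_nonneg) (fun x => hf x y) ?_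
    have h1 : Tendsto (fun x : E => dist x y) (𝓝 y) (𝓝 0) := by
      simpa using (continuous_id.dist continuous_const : Continuous fun x : E => dist x y).tendsto y
    have := (h1.rpow_const (Or.inr hα.le)).const_mul C
    simpa [Real.zero_rpow hα.ne'] using this
  -- McShane's infimum formula. For `α > 1` the power `dist ^ α` satisfies the triangle inequality
  -- only up to the factor `2 ^ α`.
  set B := C * 2 ^ α with hB
  have hB0 : 0 ≤ B := by positivity
  let k : ℂ → E → ℝ := fun z x => f x + B * dist z x ^ α
  have hk : Continuous ↿k := by
    have : Continuous fun p : ℂ × E => f p.2 + B * dist p.1 (p.2 : ℂ) ^ α :=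
      (hfc.comp continuous_snd).add (continuous_const.mul
        ((continuous_fst.dist (continuous_subtype_val.comp continuous_snd)).rpow_const
          fun _ => Or.inr hα.le))
    exact this
  have hlow : ∀ (z : ℂ) (x y : E), f x - B * dist z x ^ α ≤ k z y := by
    intro z x y
    have h1 := (abs_le.1 (hf x y)).2
    have h2 : dist x y ^ α ≤ 2 ^ α * (dist z (x : ℂ) ^ α + dist z (y : ℂ) ^ α) :=
      (Real.rpow_le_rpow dist_nonneg (dist_triangle_left (x : ℂ) y z) hα.le).trans
        (rpow_add_le_two_rpow_mul dist_nonneg dist_nonneg hα.le)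
    have h3 := mul_le_mul_of_nonneg_left h2 hC
    simp only [k, hB]
    nlinarith
  refine ⟨fun z => sInf (k z '' univ), B, isCompact_univ.continuous_sInf hk, hB0, fun z x => ?_⟩
  have h1 : sInf (k z '' univ) ≤ k z x := csInf_le
    ⟨f x - B * dist z x ^ α, by rintro _ ⟨y, -, rfl⟩; exact hlow z x y⟩ ⟨x, mem_univ x, rfl⟩
  have h2 : f x - B * dist z x ^ α ≤ sInf (k z '' univ) :=
    le_csInf (univ_nonempty.image _) (by rintro _ ⟨y, -, rfl⟩; exact hlow z x y)
  rw [abs_le]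
  constructor
  · linarith
  · have : k z x = f x + B * dist z x ^ α := rfl
    linarith

/-- Whitney's extension theorem for a function on a compact set that satisfies a Hölder condition
of exponent greater than one. -/
theorem exists_contDiff_extension_of_rpow {E : Set ℂ} (hE : IsCompact E) (hne : E.Nonempty)
    {f : E → ℝ} {C α : ℝ} (hC : 0 ≤ C) (hα : 1 < α)
    (hf : ∀ x y : E, |f x - f y| ≤ C * dist x y ^ α) :
    ∃ F : ℂ → ℝ, ContDiff ℝ 1 F ∧ (∀ x ∈ E, fderiv ℝ F x = 0) ∧ ∀ x : E, F x = f x := by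
  have hα0 : 0 < α := by linarith
  obtain ⟨g, B, hg, hB, hgf⟩ := exists_continuous_extension_of_rpow hE hne hC hα0 hf
  obtain ⟨M, hM, hmol⟩ := exists_mollification
  let ε : ℕ → ℝ := fun n => (1 / 2) ^ n
  have hε : ∀ n, 0 < ε n := fun n => by positivity
  have hε1 : ∀ n, ε n ≤ 1 := fun n => pow_le_one₀ (by norm_num) (by norm_num)
  have hεs : ∀ n, ε (n + 1) = ε n / 2 := fun n => by simp only [ε, pow_succ]; ring
  choose G hG hGb using fun n => hmol (ε n) (hε n) g hg
  -- The cutoff is 1 within `2 ε n` of `E` and 0 beyond `3 ε n`. After mollification at scale `ε n`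
  -- it is still 1 with zero derivative on `E`, and vanishes beyond `4 ε n`.
  let k : ℕ → ℂ → ℝ := fun n u => max 0 (min 1 (3 - Metric.infDist u E / ε n))
  have hk : ∀ n, Continuous (k n) := fun n =>
    continuous_const.max (continuous_const.min
      (continuous_const.sub ((Metric.continuous_infDist_pt E).div_const _)))
  choose X hX hXb using fun n => hmol (ε n) (hε n) (k n) (hk n)
  -- The 5 is 4 for the distance from `E` to the support of the cutoff, plus 1 for the mollification
  -- window.
  set η : ℕ → ℝ := fun n => M * (B * (5 * ε n) ^ α) with hη
  have hη0 : ∀ n, 0 ≤ η n := fun n => by have := hε n; positivity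
  have hnear : ∀ n (z : ℂ) (x : E) r, 0 ≤ r → dist z x ≤ 4 * r → r ≤ ε n → ∀ y : ℂ, dist y z ≤ r →
      |g y - f x| ≤ B * (5 * ε n) ^ α := by
    intro n z x r hr hzx hrε y hy
    refine (hgf y x).trans (mul_le_mul_of_nonneg_left ?_ hB)
    refine Real.rpow_le_rpow dist_nonneg ?_ hα0.le
    linarith [dist_triangle y z x]
  have hG0 : ∀ n (z : ℂ) (x : E), dist z x ≤ 4 * ε n →
      |G n z - f x| ≤ η n ∧ ‖fderiv ℝ (G n) z‖ ≤ η n / ε n := by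
    intro n z x hzx
    refine hGb n z (f x) _ fun y hy => ?_
    exact hnear n z x (ε n) (hε n).le hzx le_rfl y hy
  have hG1 : ∀ n (z : ℂ) (x : E), dist z x ≤ 4 * ε n →
      |G (n + 1) z - f x| ≤ η n ∧ ‖fderiv ℝ (G (n + 1)) z‖ ≤ 2 * (η n / ε n) := by
    intro n z x hzx
    have := hGb (n + 1) z (f x) (B * (5 * ε n) ^ α) fun y hy => by
      rw [hεs] at hy
      exact hnear n z x (ε n) (hε n).le hzx le_rfl y (by linarith [hε n])
    refine ⟨this.1, this.2.trans_eq ?_⟩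
    have := (hε n).ne'
    rw [hεs]
    simp only [hη]
    field_simp
  have hXE : ∀ n, ∀ x ∈ E, X n x = 1 ∧ fderiv ℝ (X n) x = 0 := by
    intro n x hx
    have := hXb n x 1 0 fun y hy => by
      have h1 : Metric.infDist y E / ε n ≤ 1 :=
        (div_le_one (hε n)).2 ((Metric.infDist_le_dist_of_mem hx).trans hy)
      have : k n y = 1 := by
        simp only [k]
        rw [min_eq_left (by linarith), max_eq_right zero_le_one]
      simp [this]
    simp only [mul_zero, zero_div, abs_nonpos_iff, norm_le_zero_iff, sub_eq_zero] at this
    exact this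
  have hXfar : ∀ n z, 4 * ε n ≤ Metric.infDist z E → X n z = 0 ∧ fderiv ℝ (X n) z = 0 := by
    intro n z hz
    have := hXb n z 0 0 fun y hy => by
      have h0 : Metric.infDist z E ≤ Metric.infDist y E + dist z y :=
        Metric.infDist_le_infDist_add_dist
      rw [dist_comm] at h0
      have h1 : 3 ≤ Metric.infDist y E / ε n := (le_div_iff₀ (hε n)).2 (by linarith)
      have : k n y = 0 := by
        simp only [k]
        exact max_eq_left ((min_le_right _ _).trans (by linarith))
      simp [this]
    simpa using this
  have hXle : ∀ n z, |X n z| ≤ M ∧ ‖fderiv ℝ (X n) z‖ ≤ M / ε n := by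
    intro n z
    have := hXb n z 0 1 fun y _ => by
      rw [sub_zero, abs_le]
      constructor
      · linarith [le_max_left 0 (min 1 (3 - Metric.infDist y E / ε n))]
      · exact max_le zero_le_one (min_le_left _ _)
    simpa using this
  have hGd : ∀ n z, DifferentiableAt ℝ (G n) z := fun n z =>
    (hG n).contDiffAt.differentiableAt one_ne_zero
  have hXd : ∀ n z, DifferentiableAt ℝ (X n) z := fun n z =>
    (hX n).contDiffAt.differentiableAt one_ne_zero
  -- Correction from scale `ε n` to `ε (n + 1)`, localized near `E`, where the Hölder bound controls
  -- it. On `E` the cutoff is invisible to first order, so `G 0 + ∑ D n` telescopes there to `lim G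
  -- n = f`, with derivative `lim fderiv (G n) = 0`.
  let D : ℕ → ℂ → ℝ := fun n z => X n z * (G (n + 1) z - G n z)
  have hD : ∀ n, ContDiff ℝ 1 (D n) := fun n => (hX n).mul ((hG (n + 1)).sub (hG n))
  have hDf : ∀ n z, fderiv ℝ (D n) z = X n z • (fderiv ℝ (G (n + 1)) z - fderiv ℝ (G n) z) +
      (G (n + 1) z - G n z) • fderiv ℝ (X n) z := by
    intro n z
    have := ((hXd n z).hasFDerivAt.mul ((hGd (n + 1) z).hasFDerivAt.sub
      (hGd n z).hasFDerivAt)).fderiv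
    exact this
  set u : ℕ → ℝ := fun n => 5 * M * (η n / ε n) with hu
  have hDb : ∀ n z, |D n z| ≤ u n ∧ ‖fderiv ℝ (D n) z‖ ≤ u n := by
    intro n z
    have hq : 0 ≤ η n / ε n := div_nonneg (hη0 n) (hε n).le
    have hηε : η n ≤ η n / ε n := by
      rw [le_div_iff₀ (hε n)]
      exact mul_le_of_le_one_right (hη0 n) (hε1 n)
    rcases le_or_gt (4 * ε n) (Metric.infDist z E) with hz | hz
    · obtain ⟨h1, h2⟩ := hXfar n z hz
      have : 0 ≤ u n := by positivity
      rw [hDf]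
      simp only [D, h1, h2]
      simpa using this
    · obtain ⟨x, hx, hzx⟩ := (Metric.infDist_lt_iff hne).1 hz
      obtain ⟨a0, b0⟩ := hG0 n z ⟨x, hx⟩ hzx.le
      obtain ⟨a1, b1⟩ := hG1 n z ⟨x, hx⟩ hzx.le
      obtain ⟨c0, c1⟩ := hXle n z
      have h1 : |G (n + 1) z - G n z| ≤ 2 * η n := by
        have := abs_sub_le (G (n + 1) z) (f ⟨x, hx⟩) (G n z)
        rw [abs_sub_comm (f ⟨x, hx⟩)] at this
        linarith
      have h2 : ‖fderiv ℝ (G (n + 1)) z - fderiv ℝ (G n) z‖ ≤ 3 * (η n / ε n) :=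
        (norm_sub_le _ _).trans (by linarith)
      constructor
      · calc |D n z| = |X n z| * |G (n + 1) z - G n z| := abs_mul _ _
          _ ≤ M * (2 * η n) := by gcongr
          _ ≤ u n := by simp only [hu]; nlinarith
      · rw [hDf]
        calc _ ≤ |X n z| * ‖fderiv ℝ (G (n + 1)) z - fderiv ℝ (G n) z‖ +
              |G (n + 1) z - G n z| * ‖fderiv ℝ (X n) z‖ := by
              refine (norm_add_le _ _).trans_eq ?_
              rw [norm_smul, norm_smul, Real.norm_eq_abs, Real.norm_eq_abs]
          _ ≤ M * (3 * (η n / ε n)) + 2 * η n * (M / ε n) := by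
              gcongr
          _ = u n := by simp only [hu]; ring
  set θ : ℝ := (1 / 2) ^ (α - 1) with hθ
  have hθ0 : 0 ≤ θ := by positivity
  have hθ1 : θ < 1 := Real.rpow_lt_one (by norm_num) (by norm_num) (by linarith)
  -- This is where `α > 1` enters: the derivative bounds decay geometrically with ratio `2 ^ (1 - α)
  -- < 1`.
  have hηθ : ∀ n, η n / ε n = M * (B * 5 ^ α) * θ ^ n := by
    intro n
    have h1 : ε n ^ α = θ ^ n * ε n := by
      simp only [ε, hθ]
      rw [← Real.rpow_natCast_mul (by norm_num), mul_comm, Real.rpow_mul_natCast (by norm_num),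
        ← mul_pow, ← Real.rpow_add_one (by norm_num), sub_add_cancel]
    simp only [hη]
    rw [Real.mul_rpow (by norm_num) (hε n).le, h1]
    have := (hε n).ne'
    field_simp
  have hus : Summable u := by
    simp only [hu, hηθ]
    exact ((summable_geometric_of_lt_one hθ0 hθ1).mul_left _).mul_left _
  have hq0 : Tendsto (fun n => η n / ε n) atTop (𝓝 0) := by
    simp only [hηθ]
    simpa using (tendsto_pow_atTop_nhds_zero_of_lt_one hθ0 hθ1).const_mul (M * (B * 5 ^ α))
  have hηlim : Tendsto η atTop (𝓝 0) := by
    refine squeeze_zero hη0 (fun n => ?_) hq0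
    rw [le_div_iff₀ (hε n)]
    exact mul_le_of_le_one_right (hη0 n) (hε1 n)
  have hsumD : ∀ z, Summable fun n => D n z := fun z =>
    Summable.of_norm_bounded hus fun n => (hDb n z).1
  have hDd : ∀ n, Differentiable ℝ (D n) := fun n => (hD n).differentiable one_ne_zero
  have htsum : ContDiff ℝ 1 fun z => ∑' n, D n z := by
    refine contDiff_tsum (N := 1) (v := fun _ => u) (fun n => hD n) (fun _ _ => hus) ?_
    intro j n z hj
    have hj : j ≤ 1 := by exact_mod_cast hj
    interval_cases j
    · rw [norm_iteratedFDeriv_zero]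
      exact (hDb n z).1
    · rw [norm_iteratedFDeriv_one]
      exact (hDb n z).2
  refine ⟨fun z => G 0 z + ∑' n, D n z, (hG 0).add htsum, fun x hx => ?_, fun x => ?_⟩
  · have hfd : fderiv ℝ (fun z => ∑' n, D n z) x = ∑' n, fderiv ℝ (D n) x :=
      fderiv_tsum_apply hus hDd (fun n z => (hDb n z).2) (hsumD x) x
    have hs' : Summable fun n => fderiv ℝ (D n) x :=
      Summable.of_norm_bounded hus fun n => (hDb n x).2
    have hterm : ∀ n, fderiv ℝ (D n) x = fderiv ℝ (G (n + 1)) x - fderiv ℝ (G n) x := by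
      intro n
      obtain ⟨h1, h2⟩ := hXE n x hx
      rw [hDf, h1, h2, one_smul, smul_zero, add_zero]
    have hlim : Tendsto (fun n => fderiv ℝ (G n) x) atTop (𝓝 0) := by
      refine squeeze_zero_norm (fun n => ?_) hq0
      exact (hG0 n x ⟨x, hx⟩ (by simpa using (hε n).le)).2
    have hval : ∑' n, fderiv ℝ (D n) x = 0 - fderiv ℝ (G 0) x := by
      refine tendsto_nhds_unique hs'.hasSum.tendsto_sum_nat ?_
      simp only [hterm]
      simp only [Finset.sum_range_sub (fun n => fderiv ℝ (G n) x)]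
      exact hlim.sub_const _
    rw [fderiv_fun_add (hGd 0 x) (htsum.contDiffAt.differentiableAt one_ne_zero), hfd, hval]
    simp
  · have hterm : ∀ n, D n x = G (n + 1) x - G n x := by
      intro n
      simp only [D, (hXE n x x.2).1, one_mul]
    have hlim : Tendsto (fun n => G n x) atTop (𝓝 (f x)) := by
      refine tendsto_iff_dist_tendsto_zero.2 (squeeze_zero (fun _ => dist_nonneg) (fun n => ?_)
        hηlim)
      exact (hG0 n x x (by simpa using (hε n).le)).1
    have hval : ∑' n, D n (x : ℂ) = f x - G 0 x := by
      refine tendsto_nhds_unique (hsumD x).hasSum.tendsto_sum_nat ?_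
      simp only [hterm]
      simp only [Finset.sum_range_sub (fun n => G n x)]
      exact hlim.sub_const _
    simp only [hval]
    ring

/-! ### Subarcs and their Hausdorff measure -/

section Arc

variable {Λ : Set ℂ} (h : I ≃ₜ Λ)

lemma isInducing_coe_comp : IsInducing fun u : I => (h u : ℂ) :=
  IsInducing.subtypeVal.comp h.isInducing

lemma injective_coe_comp : Function.Injective fun u : I => (h u : ℂ) :=
  Subtype.val_injective.comp h.injective

lemma image_coe_comp_preimage {Q : Set ℂ} (hQ : Q ⊆ Λ) :
    (fun u : I => (h u : ℂ)) '' {u | (h u : ℂ) ∈ Q} = Q := by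
  refine Subset.antisymm (by rintro _ ⟨u, hu, rfl⟩; exact hu) fun z hz => ?_
  exact ⟨h.symm ⟨z, hQ hz⟩, by simpa using hz, by simp⟩

lemma isPreconnected_preimage_coe_comp {Q : Set ℂ} (hQ : Q ⊆ Λ) (hc : IsPreconnected Q) :
    IsPreconnected {u : I | (h u : ℂ) ∈ Q} := by
  rw [← (isInducing_coe_comp h).isPreconnected_image, image_coe_comp_preimage h hQ]
  exact hc

lemma isConnected_of_arc (h : I ≃ₜ Λ) : IsConnected Λ := by
  have : Set.range (fun u : I => (h u : ℂ)) = Λ := by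
    have := Function.Surjective.range_comp h.surjective (Subtype.val : Λ → ℂ)
    simpa [Function.comp_def] using this
  rw [← this]
  exact isConnected_range (isInducing_coe_comp h).continuous

lemma subarc_subset (x y : Λ) : subarc h x y ⊆ Λ := by
  rintro _ ⟨u, -, rfl⟩
  exact (h u).2

lemma isCompact_subarc (x y : Λ) : IsCompact (subarc h x y) :=
  isCompact_uIcc.image (isInducing_coe_comp h).continuous

lemma isPreconnected_subarc (x y : Λ) : IsPreconnected (subarc h x y) :=
  isPreconnected_uIcc.image _ (isInducing_coe_comp h).continuous.continuousOn

lemma left_mem_subarc (x y : Λ) : (x : ℂ) ∈ subarc h x y :=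
  ⟨h.symm x, left_mem_uIcc, by simp⟩

lemma right_mem_subarc (x y : Λ) : (y : ℂ) ∈ subarc h x y :=
  ⟨h.symm y, right_mem_uIcc, by simp⟩

lemma subarc_comm (x y : Λ) : subarc h x y = subarc h y x := by
  rw [subarc, subarc, uIcc_comm]

/-- A subarc lies in every connected subset of the arc that contains its end points. -/
lemma subarc_subset_of_isPreconnected {Q : Set ℂ} (hQ : Q ⊆ Λ) (hc : IsPreconnected Q) {x y : Λ}
    (hx : (x : ℂ) ∈ Q) (hy : (y : ℂ) ∈ Q) : subarc h x y ⊆ Q := by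
  have hT := (isPreconnected_preimage_coe_comp h hQ hc).ordConnected
  rintro _ ⟨u, hu, rfl⟩
  exact hT.uIcc_subset (x := h.symm x) (y := h.symm y) (by simpa using hx) (by simpa using hy) hu

/-- A connected subset of the arc that meets a subarc and avoids its end points lies in it. -/
lemma subset_subarc_of_isPreconnected {Q : Set ℂ} (hQ : Q ⊆ Λ) (hc : IsPreconnected Q) {x y : Λ}
    (hx : (x : ℂ) ∉ Q) (hy : (y : ℂ) ∉ Q) {p : ℂ} (hp : p ∈ Q) (hp' : p ∈ subarc h x y) :
    Q ⊆ subarc h x y := by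
  have hT := (isPreconnected_preimage_coe_comp h hQ hc).ordConnected
  set T := {u : I | (h u : ℂ) ∈ Q} with hTdef
  have ha : h.symm x ∉ T := by simpa [hTdef] using hx
  have hb : h.symm y ∉ T := by simpa [hTdef] using hy
  obtain ⟨v, hv, rfl⟩ := hp'
  have hvT : v ∈ T := hp
  intro z hz
  refine ⟨h.symm ⟨z, hQ hz⟩, ?_, by simp⟩
  have hu : h.symm ⟨z, hQ hz⟩ ∈ T := by simpa [hTdef] using hz
  generalize h.symm ⟨z, hQ hz⟩ = u at hu ⊢
  have hmin : min (h.symm x) (h.symm y) ∉ T := by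
    rcases min_choice (h.symm x) (h.symm y) with e | e <;> rwa [e]
  have hmax : max (h.symm x) (h.symm y) ∉ T := by
    rcases max_choice (h.symm x) (h.symm y) with e | e <;> rwa [e]
  constructor
  · by_contra hlt
    exact hmin (hT.out hu hvT ⟨(not_le.1 hlt).le, hv.1⟩)
  · by_contra hlt
    exact hmax (hT.out hvT hu ⟨hv.2, (not_le.1 hlt).le⟩)

/-- A subarc has a point far from both of its end points. -/
lemma exists_mem_subarc_far (x y : Λ) (hd : 0 < Metric.diam (subarc h x y)) :
    ∃ p ∈ subarc h x y, Metric.diam (subarc h x y) / 8 ≤ dist p x ∧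
      Metric.diam (subarc h x y) / 8 ≤ dist p y := by
  set δ := Metric.diam (subarc h x y) with hδ
  -- Otherwise two balls of radius `δ / 8` about the end points cover the subarc. By connectedness
  -- they meet, so the subarc lies in a ball of radius `3 δ / 8`, too small for diameter `δ`.
  by_contra! hcon
  have hcov : subarc h x y ⊆ Metric.ball (x : ℂ) (δ / 8) ∪ Metric.ball (y : ℂ) (δ / 8) := by
    intro p hp
    rcases lt_or_ge (dist p x) (δ / 8) with h1 | h1
    · exact Or.inl h1
    · exact Or.inr (hcon p hp h1)
  obtain ⟨q, -, hqx, hqy⟩ := isPreconnected_subarc h x y _ _ Metric.isOpen_ball Metric.isOpen_ball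
    hcov ⟨x, left_mem_subarc h x y, Metric.mem_ball_self (by positivity)⟩
    ⟨y, right_mem_subarc h x y, Metric.mem_ball_self (by positivity)⟩
  have hxy : dist (y : ℂ) x ≤ δ / 8 + δ / 8 :=
    (dist_triangle_left _ _ q).trans (add_le_add hqy.le hqx.le)
  have hsub : subarc h x y ⊆ Metric.closedBall (x : ℂ) (3 * δ / 8) := by
    intro p hp
    rw [Metric.mem_closedBall]
    rcases hcov hp with h1 | h1
    · have : dist p x < δ / 8 := h1
      linarith
    · have : dist p y < δ / 8 := h1
      linarith [dist_triangle p y x]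
  have := Metric.diam_le_of_subset_closedBall (by positivity) hsub
  linarith

variable {h}

lemma measurableSet_image_Icc (a b : I) :
    MeasurableSet ((fun u : I => (h u : ℂ)) '' Icc a b) :=
  (isCompact_Icc.image (isInducing_coe_comp h).continuous).measurableSet

variable (h)

/-- The increments of the Hausdorff measure function are the measures of subarcs. -/
lemma abs_hausdorffFunction_sub {s : ℝ} (hs : 0 < s) (hfin : μH[s] Λ < ∞) (x y : Λ) :
    |hausdorffFunction h s x - hausdorffFunction h s y| = (μH[s] (subarc h x y)).toReal := by
  wlog hxy : h.symm x ≤ h.symm y generalizing x y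
  · rw [abs_sub_comm, subarc_comm]
    exact this y x (le_of_not_ge hxy)
  have := Measure.nullSingletonClass_hausdorff ℂ hs
  let g : I → ℂ := fun u => h u
  have hsub : ∀ A : Set I, g '' A ⊆ Λ := by
    rintro A _ ⟨u, -, rfl⟩
    exact (h u).2
  have hlt : ∀ A : Set I, μH[s] (g '' A) ≠ ∞ := fun A =>
    ((measure_mono (hsub A)).trans_lt hfin).ne
  have hf : ∀ z : Λ, hausdorffFunction h s z = (μH[s] (g '' Icc 0 (h.symm z))).toReal := by
    intro z
    rw [hausdorffFunction, subarc, h.symm_apply_apply, uIcc_of_le unitInterval.nonneg']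
  have hunion : g '' Icc 0 (h.symm y) = g '' Icc 0 (h.symm x) ∪ g '' Icc (h.symm x) (h.symm y) := by
    rw [← image_union, Icc_union_Icc_eq_Icc unitInterval.nonneg' hxy]
  -- Consecutive subarcs share one point, which is null since `s > 0`.
  have hdisj : AEDisjoint μH[s] (g '' Icc 0 (h.symm x)) (g '' Icc (h.symm x) (h.symm y)) := by
    rw [AEDisjoint, ← image_inter (injective_coe_comp h)]
    have : Icc 0 (h.symm x) ∩ Icc (h.symm x) (h.symm y) ⊆ {h.symm x} := fun u hu =>
      le_antisymm hu.1.2 hu.2.1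
    refine measure_mono_null (image_mono this) ?_
    rw [image_singleton]
    exact measure_singleton _
  have hadd : (μH[s] (g '' Icc 0 (h.symm y))).toReal = (μH[s] (g '' Icc 0 (h.symm x))).toReal +
      (μH[s] (g '' Icc (h.symm x) (h.symm y))).toReal := by
    rw [hunion, measure_union₀ (measurableSet_image_Icc _ _).nullMeasurableSet hdisj,
      ENNReal.toReal_add (hlt _) (hlt _)]
  rw [hf, hf, hadd, abs_sub_comm, add_sub_cancel_left, abs_of_nonneg ENNReal.toReal_nonneg,
    subarc, uIcc_of_le hxy]

/-- The distance to an end point is 1-Lipschitz and maps the connected arc onto a set containing a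
nondegenerate interval. -/
lemma one_le_dimH_of_arc (h : I ≃ₜ Λ) : 1 ≤ dimH Λ := by
  let a : ℂ := (h 0).val
  let b : ℂ := (h 1).val
  have hab : a ≠ b := fun e => zero_ne_one (injective_coe_comp h e)
  have hL : LipschitzWith 1 fun z : ℂ => dist a z := LipschitzWith.dist_right a
  have hpre : IsPreconnected ((fun z : ℂ => dist a z) '' Λ) :=
    (isConnected_of_arc h).isPreconnected.image _ hL.continuous.continuousOn
  have hIcc : Icc 0 (dist a b) ⊆ (fun z : ℂ => dist a z) '' Λ :=
    hpre.Icc_subset ⟨a, (h 0).2, dist_self a⟩ ⟨b, (h 1).2, rfl⟩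
  have hint : (interior ((fun z : ℂ => dist a z) '' Λ)).Nonempty := by
    refine Nonempty.mono (interior_mono hIcc) ?_
    rw [interior_Icc]
    exact nonempty_Ioo.2 (dist_pos.2 hab)
  have := Real.dimH_of_nonempty_interior hint
  rw [Module.finrank_self, Nat.cast_one] at this
  rw [← this]
  exact hL.dimH_image_le Λ

/-- Lower regularity of the Hausdorff measure on the subarcs of a self-similar arc. -/
theorem SimilitudeSystem.IsInvariant.exists_mul_diam_subarc_le {ι : Type*} [Finite ι] [Nonempty ι]
    {Φ : SimilitudeSystem ι} (hΛ : Φ.IsInvariant Λ) {s : ℝ} (hs : 0 < s)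
    (hpos : 0 < μH[s] Λ) (hfin : μH[s] Λ < ∞) :
    ∃ c : ℝ, 0 < c ∧ ∀ x y : Λ,
      c * Metric.diam (subarc h x y) ^ s ≤ (μH[s] (subarc h x y)).toReal := by
  have hcomp : IsCompact Λ := by
    rw [isCompact_iff_compactSpace]
    exact h.compactSpace
  obtain ⟨m, hm, hm'⟩ := Φ.exists_pos_le_norm_a
  -- Pieces of ratio at most `δ / R` have diameter below `δ / 8`, so the piece through the far point
  -- `p` misses both end points and hence stays inside the subarc.
  set R := 16 * (Metric.diam Λ + 1) with hR
  have hdiam : 0 ≤ Metric.diam Λ := Metric.diam_nonneg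
  have hR0 : 0 < R := by positivity
  have hH : 0 < (μH[s] Λ).toReal := ENNReal.toReal_pos hpos.ne' hfin.ne
  refine ⟨(m / R) ^ s * (μH[s] Λ).toReal, by positivity, fun x y => ?_⟩
  rcases (Metric.diam_nonneg (s := subarc h x y)).eq_or_lt with h0 | h0
  · rw [← h0, Real.zero_rpow hs.ne', mul_zero]
    exact ENNReal.toReal_nonneg
  obtain ⟨p, hp, hpx, hpy⟩ := exists_mem_subarc_far h x y h0
  set δ := Metric.diam (subarc h x y) with hδ
  have hδΛ : δ ≤ Metric.diam Λ := Metric.diam_mono (subarc_subset h x y) hcomp.isBounded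
  obtain ⟨ω, hω⟩ := hΛ.exists_address (subarc_subset h x y hp)
  have hd : 0 < δ / R := by positivity
  obtain ⟨n, hn⟩ := Φ.exists_isStopping ω hd
  have hd1 : δ / R < 1 := (div_lt_one hR0).2 (by linarith)
  set w := initialWord ω n
  have hlow : m * (δ / R) ≤ Φ.scale w := hn.mul_le_scale hm hm' hd1
  have hQΛ : Φ.word w '' Λ ⊆ Λ := Φ.image_word_subset hΛ.image_subset w
  have hQd : ∀ q ∈ Φ.word w '' Λ, dist p q < δ / 8 := by
    rintro _ ⟨b, hb, rfl⟩
    obtain ⟨a, ha, hap⟩ := hω n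
    rw [← hap, Φ.dist_word]
    have h1 := Metric.dist_le_diam_of_mem hcomp.isBounded ha hb
    calc Φ.scale w * dist a b ≤ δ / R * Metric.diam Λ :=
          mul_le_mul hn.1 h1 dist_nonneg hd.le
      _ < δ / 8 := by
          rw [div_mul_eq_mul_div, div_lt_div_iff₀ hR0 (by norm_num), hR]
          nlinarith
  have hQc : IsPreconnected (Φ.word w '' Λ) :=
    (isConnected_of_arc h).isPreconnected.image _ (Φ.continuous_word w).continuousOn
  have hQ : Φ.word w '' Λ ⊆ subarc h x y :=
    subset_subarc_of_isPreconnected h hQΛ hQc (fun hx => (hQd _ hx).not_ge hpx)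
      (fun hy => (hQd _ hy).not_ge hpy) (hω n) hp
  have hle := ENNReal.toReal_mono
    ((measure_mono (subarc_subset h x y)).trans_lt hfin).ne (measure_mono hQ (μ := μH[s]))
  rw [Φ.hausdorffMeasure_image_word hs.le, ENNReal.toReal_mul, ENNReal.toReal_ofReal
    (Real.rpow_nonneg (Φ.scale_pos w).le s)] at hle
  refine le_trans ?_ hle
  calc (m / R) ^ s * (μH[s] Λ).toReal * δ ^ s = (m * (δ / R)) ^ s * (μH[s] Λ).toReal := by
        rw [mul_right_comm, ← Real.mul_rpow (by positivity) h0.le]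
        congr 2
        ring
    _ ≤ Φ.scale w ^ s * (μH[s] Λ).toReal := by gcongr

end Arc

/-! ### Basic figures satisfy the open set condition -/

namespace PolygonData

variable {Ω : PolygonData}

lemma IsBasicFigure.base_ne (hΩ : Ω.IsBasicFigure) : Ω.A Ω.ℓ - Ω.A 0 ≠ 0 := fun h => by
  have := hΩ.apex_pos
  simp [h] at this

/-- With a single edge, `S 1` would have ratio 1. -/
lemma IsBasicFigure.two_le (hΩ : Ω.IsBasicFigure) : 2 ≤ Ω.ℓ := by
  by_contra hlt
  have hne := hΩ.base_ne
  have : Ω.ℓ ≠ 0 := fun h => hne (by rw [h, sub_self])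
  have h1 : Ω.ℓ = 1 := by lia
  have := hΩ.ratio_lt_one 1 (by simp [h1])
  rw [h1] at hne
  simp [ratio, h1, div_self hne] at this

/-- The similitudes of a basic figure. -/
noncomputable def IsBasicFigure.system (hΩ : Ω.IsBasicFigure) :
    SimilitudeSystem (Icc 1 Ω.ℓ) where
  a j := (Ω.A j - Ω.A (j - 1)) / (Ω.A Ω.ℓ - Ω.A 0)
  b j := Ω.A (j - 1) - (Ω.A j - Ω.A (j - 1)) / (Ω.A Ω.ℓ - Ω.A 0) * Ω.A 0
  a_ne_zero j := norm_pos_iff.1 (hΩ.ratio_pos j j.2)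
  norm_a_lt_one j := hΩ.ratio_lt_one j j.2

lemma IsBasicFigure.system_map (hΩ : Ω.IsBasicFigure) (j : Icc 1 Ω.ℓ) :
    hΩ.system.map j = Ω.S j := by
  ext z
  simp only [SimilitudeSystem.map, system, S]
  ring

lemma S_base_left (j : ℕ) : Ω.S j (Ω.A 0) = Ω.A (j - 1) := by simp [S]

lemma IsBasicFigure.S_base_right (hΩ : Ω.IsBasicFigure) (j : ℕ) :
    Ω.S j (Ω.A Ω.ℓ) = Ω.A j := by
  rw [S, div_mul_cancel₀ _ hΩ.base_ne, sub_add_cancel]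

lemma IsBasicFigure.openTriangle_nonempty (hΩ : Ω.IsBasicFigure) : Ω.openTriangle.Nonempty := by
  rw [openTriangle, interior_convexHull_nonempty_iff_affineSpan_eq_top]
  set T := affineSpan ℝ {Ω.A 0, Ω.A Ω.ℓ, Ω.A Ω.q}
  have h0 : Ω.A 0 ∈ T := subset_affineSpan ℝ _ (by simp)
  have h1 : Ω.A Ω.ℓ ∈ T := subset_affineSpan ℝ _ (by simp)
  have h2 : Ω.A Ω.q ∈ T := subset_affineSpan ℝ _ (by simp)
  rw [eq_top_iff]
  rintro z -
  have hu := hΩ.base_ne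
  have hτ := hΩ.apex_pos
  set u := Ω.A Ω.ℓ - Ω.A 0 with hudef
  set τ := (Ω.A Ω.q - Ω.A 0) / u with hτdef
  set ζ := (z - Ω.A 0) / u with hζ
  have hv : Ω.A Ω.q - Ω.A 0 = τ * u := by rw [hτdef, div_mul_cancel₀ _ hu]
  have hz : z = ζ * u + Ω.A 0 := by rw [hζ, div_mul_cancel₀ _ hu, sub_add_cancel]
  -- Real coordinates of `ζ` in the basis `1, τ` of the plane, which is a basis because `τ` has
  -- nonzero imaginary part.
  have hy := T.smul_vsub_vadd_mem (ζ.im / τ.im) h2 h0 h0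
  have hx := T.smul_vsub_vadd_mem (ζ.re - ζ.im / τ.im * τ.re) h1 h0 hy
  convert hx using 1
  simp only [vsub_eq_sub, vadd_eq_add, ← hudef, hv, Complex.real_smul]
  have hcoef : ζ = ((ζ.re - ζ.im / τ.im * τ.re : ℝ) : ℂ) + ((ζ.im / τ.im : ℝ) : ℂ) * τ := by
    apply Complex.ext
    · simp
    · simp [div_mul_cancel₀ _ hτ.ne']
  conv_lhs => rw [hz, hcoef]
  ring

lemma isClosed_triangle : IsClosed (convexHull ℝ {Ω.A 0, Ω.A Ω.ℓ, Ω.A Ω.q}) :=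
  ((toFinite {Ω.A 0, Ω.A Ω.ℓ, Ω.A Ω.q}).isCompact_convexHull ℝ).isClosed

lemma convex_preimage_S {D : Set ℂ} (hD : Convex ℝ D) (j : ℕ) : Convex ℝ (Ω.S j ⁻¹' D) := by
  intro x hx y hy a b ha hb hab
  have : Ω.S j (a • x + b • y) = a • Ω.S j x + b • Ω.S j y := by
    have hab' : (a : ℂ) + b = 1 := by exact_mod_cast hab
    have hb' : (b : ℂ) = 1 - a := by rw [← hab']; ring
    simp only [S, Complex.real_smul, hb']
    ring
  rw [mem_preimage, this]
  exact hD hx hy ha hb hab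

lemma IsBasicFigure.vertex_mem_triangle (hΩ : Ω.IsBasicFigure) {j : ℕ} (hj : j ≤ Ω.ℓ) :
    Ω.A j ∈ convexHull ℝ {Ω.A 0, Ω.A Ω.ℓ, Ω.A Ω.q} := by
  rcases hΩ.vertex_mem j hj with (h | h) | h
  · rw [mem_singleton_iff] at h
    rw [h]
    exact subset_convexHull ℝ _ (by simp)
  · exact segment_subset_convexHull (by simp) (by simp) h
  · exact interior_subset h

/-- Each `S j` is affine and sends the three vertices into the closed triangle, hence maps that
triangle into itself; being open, it maps the interior into the interior. -/
lemma IsBasicFigure.openSetCondition (hΩ : Ω.IsBasicFigure) :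
    hΩ.system.OpenSetCondition Ω.openTriangle where
  isOpen := isOpen_interior
  nonempty := hΩ.openTriangle_nonempty
  image_subset j := by
    have hmaps : convexHull ℝ {Ω.A 0, Ω.A Ω.ℓ, Ω.A Ω.q} ⊆
        Ω.S j ⁻¹' convexHull ℝ {Ω.A 0, Ω.A Ω.ℓ, Ω.A Ω.q} := by
      refine convexHull_min ?_ (convex_preimage_S (convex_convexHull ℝ _) j)
      rintro z (rfl | rfl | rfl)
      · rw [mem_preimage, S_base_left]
        exact hΩ.vertex_mem_triangle ((Nat.sub_le _ _).trans j.2.2)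
      · rw [mem_preimage, hΩ.S_base_right]
        exact hΩ.vertex_mem_triangle j.2.2
      · exact closure_minimal interior_subset isClosed_triangle (hΩ.apex_mem j j.2)
    have hopen : IsOpenMap (hΩ.system.map j) :=
      ((Homeomorph.mulLeft₀ _ (hΩ.system.a_ne_zero j)).trans
        (Homeomorph.addRight (hΩ.system.b j))).isOpenMap
    refine interior_maximal ?_ (hopen _ isOpen_interior)
    rw [hΩ.system_map]
    rintro _ ⟨z, hz, rfl⟩
    exact hmaps (interior_subset hz)
  disjoint i j hij := by
    rw [hΩ.system_map, hΩ.system_map]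
    exact hΩ.disjoint i i.2 j j.2 fun h => hij (Subtype.ext h)

lemma IsSelfSimilarSet.isInvariant {Λ : Set ℂ} (hΛ : Ω.IsSelfSimilarSet Λ)
    (hΩ : Ω.IsBasicFigure) : hΩ.system.IsInvariant Λ := by
  rw [SimilitudeSystem.IsInvariant]
  conv_lhs => rw [hΛ.eq_iUnion, biUnion_eq_iUnion]
  simp only [hΩ.system_map]

end PolygonData

/-! ### The proposition -/

theorem proposition6p6 (Ω : PolygonData) (Λ : Set ℂ) (hΛ : Ω.IsRegularSelfSimilarArc Λ)
    (h : unitInterval ≃ₜ Λ) (h0 : (h 0 : ℂ) ∈ Ω.S 1 '' Λ)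
    (s : ℝ) (hs : s = (dimH Λ).toReal) :
    (IsWhitneyFunctionOn Λ (hausdorffFunction h s) → IsQuasiArc s Λ) ∧
    (∀ t : ℝ, 1 ≤ t → t < s → IsQuasiArc t Λ →
      IsWhitneyFunctionOn Λ (hausdorffFunction h s)) := by
  have hΩ := hΛ.isBasicFigure
  have hinv := hΛ.isSelfSimilarSet.isInvariant hΩ
  have hcomp := hΛ.isSelfSimilarSet.isCompact
  have hne := hΛ.isSelfSimilarSet.nonempty
  have hosc := hΩ.openSetCondition
  have h2 := hΩ.two_le
  have : Nontrivial (Icc 1 Ω.ℓ) :=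
    ⟨⟨1, by simp; lia⟩, ⟨2, by simp; lia⟩, by simp⟩
  obtain ⟨d, hd, hsum⟩ := hΩ.system.exists_similarity_dimension
  have hfin := hinv.hausdorffMeasure_lt_top hcomp.isBounded hd hsum
  have hpos := hinv.hausdorffMeasure_pos hcomp hne hosc hd hsum
  have hdim : dimH Λ = d.toNNReal := by
    apply dimH_of_hausdorffMeasure_ne_zero_ne_top <;> rw [Real.coe_toNNReal d hd.le]
    exacts [hpos.ne', hfin.ne]
  -- Positive finite measure in the similarity dimension identifies it with the Hausdorff dimension.
  obtain rfl : s = d := by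
    rw [hs, hdim, ENNReal.coe_toReal, Real.coe_toNNReal d hd.le]
  clear hs
  have hs1 : 1 ≤ s := by
    have := one_le_dimH_of_arc h
    rw [hdim] at this
    simpa using this
  refine ⟨?_, ?_⟩
  · rintro ⟨-, ⟨F, hF, -, hFf⟩, -⟩
    obtain ⟨c, hc, hlow⟩ := hinv.exists_mul_diam_subarc_le h hd hpos hfin
    obtain ⟨K, hK⟩ := hF.locallyLipschitz.locallyLipschitzOn.exists_lipschitzOnWith_of_compact hcomp
    refine ⟨hs1, h, (K + 1) / c, by positivity, fun x y => ?_⟩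
    have h1 := hlow x y
    rw [← abs_hausdorffFunction_sub h hd hfin, ← hFf, ← hFf] at h1
    have h2 : |F x - F y| ≤ K * dist x y := hK.dist_le_mul x x.2 y y.2
    rw [div_mul_eq_mul_div, le_div_iff₀ hc]
    have := dist_nonneg (x := x) (y := y)
    linarith
  · rintro t ht hts ⟨-, h', C, hC, hquasi⟩
    obtain ⟨B, hB, hup⟩ :=
      hinv.exists_hausdorffMeasure_inter_le hcomp.isBounded hosc hd hsum
    have ht0 : 0 < t := by linarith
    have hα : 1 < s / t := (one_lt_div ht0).2 hts
    have hbound : ∀ x y : Λ, |hausdorffFunction h s x - hausdorffFunction h s y| ≤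
        B * C ^ (s / t) * dist x y ^ (s / t) := by
      intro x y
      rcases eq_or_ne x y with rfl | hxy
      · simp only [sub_self, abs_zero]
        positivity
      have hdist : 0 < dist x y := dist_pos.2 hxy
      rw [abs_hausdorffFunction_sub h hd hfin]
      -- The quasi-arc condition comes with its own parametrization `h'`; connectedness transfers
      -- its diameter bound to the subarcs of `h`.
      have hsub : subarc h x y ⊆ subarc h' x y :=
        subarc_subset_of_isPreconnected h (subarc_subset h' x y) (isPreconnected_subarc h' x y)
          (left_mem_subarc h' x y) (right_mem_subarc h' x y)
      have hdiam : Metric.diam (subarc h' x y) ≤ (C * dist x y) ^ t⁻¹ := by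
        rw [Real.le_rpow_inv_iff_of_pos Metric.diam_nonneg (by positivity) ht0]
        exact hquasi x y
      refine (hup ((C * dist x y) ^ t⁻¹) (by positivity) _ (subarc_subset h x y)
        fun a ha b hb => ?_).trans_eq ?_
      · exact (Metric.dist_le_diam_of_mem (isCompact_subarc h' x y).isBounded (hsub ha)
          (hsub hb)).trans hdiam
      · rw [← Real.rpow_mul (by positivity), inv_mul_eq_div, Real.mul_rpow hC.le hdist.le,
          mul_assoc]
    refine ⟨isConnected_of_arc h, exists_contDiff_extension_of_rpow hcomp hne (by positivity) hα
      hbound, h 0, h 1, fun he => ?_⟩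
    have h1 := abs_hausdorffFunction_sub h hd hfin (h 0) (h 1)
    have h2 : subarc h (h 0) (h 1) = Λ := by
      refine (subarc_subset h _ _).antisymm fun z hz => ⟨h.symm ⟨z, hz⟩, ?_, by simp⟩
      rw [h.symm_apply_apply, h.symm_apply_apply, uIcc_of_le zero_le_one]
      exact ⟨bot_le, le_top⟩
    rw [he, sub_self, abs_zero, h2] at h1
    exact (ENNReal.toReal_pos hpos.ne' hfin.ne).ne h1
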